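/- Let $E$ be an infinite-dimensional separable real Hilbert space with an orthonormal basis $\mathcal E=\{e_j\}_{j\in\mathbb N}$. For bounded real sequences $a_j<b_j$ the block $\Pi_{a,b}=\{x\in E:\ (e_j,x)\in[a_j,b_j)\ \forall j\}$ is called absolutely measurable if it is empty or $\sum_j\max\{0,\ln(b_j-a_j)\}<\infty$; put $\lambda_{\mathcal E}(\Pi_{a,b})=\prod_j(b_j-a_j)$ if $\Pi_{a,b}\ne\emptyset$ and $\lambda_{\mathcal E}(\emptyset)=0$. Let $\lambda_{\mathcal E}$ also denote the finitely additive extension to the minimal ring containing these blocks and then to the completion $\mathcal R_{\mathcal E}$ of that ring (the sets $B$ such that for each $\varepsilon>0$ there are $A_1\subset B\subset A_2$ in the ring with $\lambda_{\mathcal E}(A_2\setminus A_1)<\varepsilon$). Let $\mathcal H_{\mathcal E}$ be the complex Hilbert space obtained by completing the space of linear combinations of indicators of sets in $\mathcal R_{\mathcal E}$, modulo null functions, for the norm $\|\sum_k c_k\chi_{B_k}\|=(\sum_k|c_k|^2\lambda_{\mathcal E}(B_k))^{1/2}$ ($B_k$ pairwise disjoint). For $h\in E$ let $S_h$ be the unitary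 operator on $\mathcal H_{\mathcal E}$ extending $S_hf(x)=f(x-h)$. For a non-negative nuclear operator $A$ on $E$ for which every $e_j$ is an eigenvector, let $\nu_A$ be the centered Gaussian Borel probability measure on $E$ with Fourier transform $\xi\mapsto e^{-\frac12(A\xi,\xi)}$, and let $$\mathcal U_Af=\int_E S_hf\,d\nu_A(h),\qquad f\in\mathcal H_{\mathcal E},$$ where the integral is understood in the sense of Pettis. **Theorem.** Let $D$ be a non-negative self-adjoint nuclear operator on $E$ for which every $e_j$ is an eigenvector, and suppose that $D^{1/2}$ is not nuclear. Let $P_n$ be the orthogonal projection onto $\mathrm{span}(e_1,\dots,e_n)$ and $D_n=DP_n$. Then for all $t>0$ and $f\in\mathcal H_{\mathcal E}$ the Pettis integrals defining $\mathcal U_{tD}f$ and $\mathcal U_{tD_n}f$ exist, $$\mathcal U_{tD}f=0,\qquad\text{and}\qquad \lim_{n\to\infty}\|\mathcal U_{tD_n}f\|_{\mathcal H_{\mathcal E}}=0 .$$ In particular, $\mathcal U_{D_n}f\to0=\mathcal U_Df$. -/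

import Mathlib

noncomputable section
namespace CoordShift

open Filter Topology MeasureTheory
open scoped ComplexConjugate

section Step

variable {ι α : Type*}

/-- The step function `∑ cᵢ 1_{Aᵢ}` of a finitely supported family of coefficients. -/
def stepFun (A : ι → Set α) : (ι →₀ ℂ) →ₗ[ℂ] (α → ℂ) :=
  Finsupp.linearCombination ℂ fun i => (A i).indicator 1

/-- The number `∑ cᵢ mᵢ`. -/
def stepSum (m : ι → ℝ) : (ι →₀ ℂ) →ₗ[ℂ] ℂ :=
  Finsupp.linearCombination ℂ fun i => (m i : ℂ)

open Classical in
/-- The linear extension of `1_{Aᵢ} ↦ mᵢ` to step functions: `∑ cᵢ 1_{Aᵢ} ↦ ∑ cᵢ mᵢ` (and `0` on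
functions that are not step functions). It does not depend on the representation as soon as
`IsPositiveContent A m` holds, see `stepIntegral_stepFun`. -/
def stepIntegral (A : ι → Set α) (m : ι → ℝ) (f : α → ℂ) : ℂ :=
  if h : ∃ c : ι →₀ ℂ, stepFun A c = f then stepSum m h.choose else 0

/-- Consistency of the values `mᵢ` assigned to the sets `Aᵢ`: a nonnegative real combination of the
indicators has nonnegative total value. Proved below wherever it is used. -/
def IsPositiveContent (A : ι → Set α) (m : ι → ℝ) : Prop :=
  ∀ (s : Finset ι) (c : ι → ℝ),
    (∀ x, 0 ≤ ∑ i ∈ s, c i * (A i).indicator (fun _ => (1 : ℝ)) x) → 0 ≤ ∑ i ∈ s, c i * m i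

theorem stepFun_apply (A : ι → Set α) (c : ι →₀ ℂ) (x : α) :
    stepFun A c x = ∑ i ∈ c.support, c i * (A i).indicator (fun _ => (1 : ℂ)) x := by
  simp only [stepFun, Finsupp.linearCombination_apply, Finsupp.sum, Finset.sum_apply, Pi.smul_apply,
    smul_eq_mul]
  rfl

theorem stepSum_apply (m : ι → ℝ) (c : ι →₀ ℂ) :
    stepSum m c = ∑ i ∈ c.support, c i * m i := by
  simp only [stepSum, Finsupp.linearCombination_apply, Finsupp.sum, smul_eq_mul]

theorem indicator_re_im (A : Set α) (x : α) (z : ℂ) :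
    (z * A.indicator (fun _ => (1 : ℂ)) x).re = z.re * A.indicator (fun _ => (1 : ℝ)) x ∧
    (z * A.indicator (fun _ => (1 : ℂ)) x).im = z.im * A.indicator (fun _ => (1 : ℝ)) x := by
  by_cases h : x ∈ A <;> simp [h]

theorem stepSum_re_nonneg {A : ι → Set α} {m : ι → ℝ} (hP : IsPositiveContent A m) (c : ι →₀ ℂ)
    (h : ∀ x, 0 ≤ (stepFun A c x).re) : 0 ≤ (stepSum m c).re := by
  rw [stepSum_apply, Complex.re_sum]
  simp only [Complex.re_mul_ofReal]
  refine hP c.support (fun i => (c i).re) fun x => ?_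
  have := h x
  rw [stepFun_apply, Complex.re_sum] at this
  simpa only [(indicator_re_im _ _ _).1] using this

theorem stepSum_eq_zero {A : ι → Set α} {m : ι → ℝ} (hP : IsPositiveContent A m) (c : ι →₀ ℂ)
    (h : stepFun A c = 0) : stepSum m c = 0 := by
  have key : ∀ z : ℂ, 0 ≤ (z * stepSum m c).re := by
    intro z
    have := stepSum_re_nonneg hP (z • c) (fun x => by rw [map_smul, h]; simp)
    simpa using this
  apply Complex.ext
  · have h1 := key 1
    have h2 := key (-1)
    simp at h1 h2 ⊢; linarith
  · have h1 := key Complex.I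
    have h2 := key (-Complex.I)
    simp at h1 h2 ⊢; linarith

theorem stepIntegral_stepFun {A : ι → Set α} {m : ι → ℝ} (hP : IsPositiveContent A m)
    (c : ι →₀ ℂ) : stepIntegral A m (stepFun A c) = stepSum m c := by
  have h : ∃ c', stepFun A c' = stepFun A c := ⟨c, rfl⟩
  rw [stepIntegral, dif_pos h, ← sub_eq_zero, ← map_sub]
  exact stepSum_eq_zero hP _ (by rw [map_sub, h.choose_spec, sub_self])

theorem stepIntegral_add {A : ι → Set α} {m : ι → ℝ} (hP : IsPositiveContent A m) {f g : α → ℂ}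
    (hf : f ∈ LinearMap.range (stepFun A)) (hg : g ∈ LinearMap.range (stepFun A)) :
    stepIntegral A m (f + g) = stepIntegral A m f + stepIntegral A m g := by
  obtain ⟨c, rfl⟩ := hf
  obtain ⟨d, rfl⟩ := hg
  rw [← map_add, stepIntegral_stepFun hP, stepIntegral_stepFun hP, stepIntegral_stepFun hP, map_add]

theorem stepIntegral_smul {A : ι → Set α} {m : ι → ℝ} (hP : IsPositiveContent A m) (z : ℂ)
    {f : α → ℂ} (hf : f ∈ LinearMap.range (stepFun A)) :
    stepIntegral A m (z • f) = z * stepIntegral A m f := by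
  obtain ⟨c, rfl⟩ := hf
  rw [← map_smul, stepIntegral_stepFun hP, stepIntegral_stepFun hP, map_smul, smul_eq_mul]

theorem stepIntegral_re_nonneg {A : ι → Set α} {m : ι → ℝ} (hP : IsPositiveContent A m)
    {f : α → ℂ} (hf : f ∈ LinearMap.range (stepFun A)) (h : ∀ x, 0 ≤ (f x).re) :
    0 ≤ (stepIntegral A m f).re := by
  obtain ⟨c, rfl⟩ := hf
  rw [stepIntegral_stepFun hP]
  exact stepSum_re_nonneg hP c h

theorem conj_stepFun (A : ι → Set α) (c : ι →₀ ℂ) :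
    (fun x => conj (stepFun A c x)) = stepFun A (c.mapRange conj (map_zero _)) := by
  induction c using Finsupp.induction_linear with
  | zero => simp [stepFun]; rfl
  | add c d hc hd =>
    rw [Finsupp.mapRange_add (fun x y => map_add conj x y), map_add, map_add, ← hc, ← hd]
    funext x
    simp
  | single i z =>
    funext x
    by_cases h : x ∈ A i <;> simp [stepFun, h]

theorem stepIntegral_conj {A : ι → Set α} {m : ι → ℝ} (hP : IsPositiveContent A m)
    {f : α → ℂ} (hf : f ∈ LinearMap.range (stepFun A)) :
    stepIntegral A m (fun x => conj (f x)) = conj (stepIntegral A m f) := by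
  obtain ⟨c, rfl⟩ := hf
  rw [conj_stepFun, stepIntegral_stepFun hP, stepIntegral_stepFun hP]
  induction c using Finsupp.induction_linear with
  | zero => simp
  | add c d hc hd => rw [Finsupp.mapRange_add (fun x y => map_add conj x y), map_add, hc, hd]; simp
  | single i z => simp [stepSum]

theorem indicator_mem_range (A : ι → Set α) (i : ι) :
    (A i).indicator 1 ∈ LinearMap.range (stepFun A) :=
  ⟨Finsupp.single i 1, by simp [stepFun]⟩

theorem stepIntegral_indicator {A : ι → Set α} {m : ι → ℝ} (hP : IsPositiveContent A m) (i : ι) :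
    stepIntegral A m ((A i).indicator 1) = m i := by
  have : (A i).indicator 1 = stepFun A (Finsupp.single i 1) := by simp [stepFun]
  rw [this, stepIntegral_stepFun hP]
  simp [stepSum]

theorem mul_mem_range {A : ι → Set α}
    (hA : ∀ i j, (A i ∩ A j).indicator 1 ∈ LinearMap.range (stepFun A)) {f g : α → ℂ}
    (hf : f ∈ LinearMap.range (stepFun A)) (hg : g ∈ LinearMap.range (stepFun A)) :
    f * g ∈ LinearMap.range (stepFun A) := by
  obtain ⟨c, rfl⟩ := hf
  obtain ⟨d, rfl⟩ := hg
  induction c using Finsupp.induction_linear with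
  | zero => simp
  | add c c' hc hc' => rw [map_add, add_mul]; exact add_mem hc hc'
  | single i z =>
    induction d using Finsupp.induction_linear with
    | zero => simp
    | add c c' hc hc' => rw [map_add, mul_add]; exact add_mem hc hc'
    | single j w =>
      have : stepFun A (Finsupp.single i z) * stepFun A (Finsupp.single j w) =
          (z * w) • (A i ∩ A j).indicator 1 := by
        funext x
        by_cases h : x ∈ A i <;> by_cases h' : x ∈ A j <;> simp [stepFun, h, h']
      rw [this]
      exact Submodule.smul_mem _ _ (hA i j)

theorem stepFun_comp {A : ι → Set α} {φ : α → α} {σ : ι → ι} (hσ : ∀ i, A (σ i) = φ ⁻¹' A i)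
    (c : ι →₀ ℂ) : stepFun A c ∘ φ = stepFun A (c.mapDomain σ) := by
  induction c using Finsupp.induction_linear with
  | zero => simp
  | add c d hc hd =>
    rw [Finsupp.mapDomain_add, map_add, map_add, ← hc, ← hd]
    rfl
  | single i z =>
    funext x
    rw [Finsupp.mapDomain_single]
    by_cases h : φ x ∈ A i <;> simp [stepFun, h, hσ]

theorem comp_mem_range {A : ι → Set α} {φ : α → α} {σ : ι → ι}
    (hσ : ∀ i, A (σ i) = φ ⁻¹' A i) {f : α → ℂ} (hf : f ∈ LinearMap.range (stepFun A)) :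
    f ∘ φ ∈ LinearMap.range (stepFun A) := by
  obtain ⟨c, rfl⟩ := hf
  exact ⟨_, (stepFun_comp hσ c).symm⟩

theorem stepIntegral_comp {A : ι → Set α} {m : ι → ℝ} (hP : IsPositiveContent A m) {φ : α → α}
    {σ : ι → ι} (hσ : ∀ i, A (σ i) = φ ⁻¹' A i) (hm : ∀ i, m (σ i) = m i) {f : α → ℂ}
    (hf : f ∈ LinearMap.range (stepFun A)) :
    stepIntegral A m (f ∘ φ) = stepIntegral A m f := by
  obtain ⟨c, rfl⟩ := hf
  rw [stepFun_comp hσ, stepIntegral_stepFun hP, stepIntegral_stepFun hP]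
  simp [stepSum, Finsupp.linearCombination_mapDomain, Function.comp_def, hm]

end Step

section Aux

theorem multipliable_of_summable_max_log {f : ℕ → ℝ} (hf : ∀ j, 0 < f j)
    (hs : Summable fun j => max 0 (Real.log (f j))) : Multipliable f := by
  have h1 : Multipliable fun j => Real.exp (max 0 (Real.log (f j))) := by
    apply Real.multipliable_of_summable_log
    · intro j; positivity
    · simpa using hs
  have h2 : Multipliable fun j => Real.exp (min 0 (Real.log (f j))) := by
    refine ⟨_, tendsto_atTop_ciInf ?_ ⟨0, ?_⟩⟩
    · intro s t hst
      exact Finset.prod_le_prod_of_subset_of_le_one hst (fun i _ => by positivity) (fun i _ _ => by simp)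
    · rintro _ ⟨s, rfl⟩
      exact Finset.prod_nonneg fun i _ => by positivity
  refine (h1.mul h2).congr fun j => ?_
  rw [← Real.exp_add, max_add_min, zero_add, Real.exp_log (hf j)]

theorem exists_common_point {ι : Type*} {I : Finset ι} (hI : I.Nonempty) {lo hi x : ι → ℝ}
    (hx : ∀ i ∈ I, x i ∈ Set.Ico (lo i) (hi i)) (h : ∀ k ∈ I, ∀ l ∈ I, lo k < hi l) :
    ∃ y, (∀ i ∈ I, y ∈ Set.Ico (lo i) (hi i)) ∧ |y| ≤ ∑ i ∈ I, |x i| := by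
  obtain ⟨k, hk, hkm⟩ := I.exists_max_image lo hI
  obtain ⟨l, hl, hlm⟩ := I.exists_min_image hi hI
  have hle : ∀ i ∈ I, |x i| ≤ ∑ i ∈ I, |x i| := fun i hi =>
    Finset.single_le_sum (f := fun i => |x i|) (fun _ _ => abs_nonneg _) hi
  have hkl := h k hk l hl
  have hxk := hx k hk
  have hxl := hx l hl
  rcases lt_or_ge 0 (lo k) with h0 | h0
  · refine ⟨lo k, fun i hi => ⟨hkm i hi, hkl.trans_le (hlm i hi)⟩, le_trans ?_ (hle k hk)⟩
    rw [abs_of_pos h0]; exact hxk.1.trans (le_abs_self _)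
  rcases lt_or_ge 0 (hi l) with h1 | h1
  · exact ⟨0, fun i hi => ⟨(hkm i hi).trans h0, h1.trans_le (hlm i hi)⟩, by
      simpa using Finset.sum_nonneg fun i _ => abs_nonneg (x i)⟩
  · refine ⟨max (lo k) (x l), fun i hi => ⟨(hkm i hi).trans (le_max_left _ _),
      (max_lt hkl hxl.2).trans_le (hlm i hi)⟩, le_trans ?_ (hle l hl)⟩
    have := hxl.2
    rw [abs_of_nonpos (max_le h0 (by linarith)), abs_of_neg (by linarith : x l < 0)]
    exact neg_le_neg (le_max_right _ _)

end Aux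

section Blocks

variable {E : Type*} [NormedAddCommGroup E] [InnerProductSpace ℝ E]

/-- The set of `x ∈ E` with `(e_j, x) ∈ [lo_j, hi_j)` for all `j`. -/
def box (b : HilbertBasis ℕ ℝ E) (lo hi : ℕ → ℝ) : Set E :=
  {x | ∀ j, inner ℝ (b j) x ∈ Set.Ico (lo j) (hi j)}

/-- An absolutely measurable block with edges along the orthonormal basis: bounded sequences
`lo_j < hi_j` such that the block is empty or `∑ max(0, ln(hi_j - lo_j)) < ∞`. -/
structure AbsBlock (b : HilbertBasis ℕ ℝ E) where
  lo : ℕ → ℝ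
  hi : ℕ → ℝ
  lo_bdd : ∃ C, ∀ j, |lo j| ≤ C
  hi_bdd : ∃ C, ∀ j, |hi j| ≤ C
  lt : ∀ j, lo j < hi j
  meas : box b lo hi = ∅ ∨ Summable fun j => max 0 (Real.log (hi j - lo j))

variable {b : HilbertBasis ℕ ℝ E}

/-- The block as a subset of `E`. -/
def AbsBlock.carrier (Q : AbsBlock b) : Set E := box b Q.lo Q.hi

open Classical in
/-- The volume `∏ (hi_j - lo_j)` of a nonempty block, and `0` for an empty one. The product converges
(possibly to `0`), see `multipliable_of_summable_max_log`. -/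
def AbsBlock.vol (Q : AbsBlock b) : ℝ :=
  if Q.carrier = ∅ then 0 else ∏' j, (Q.hi j - Q.lo j)

theorem AbsBlock.tendsto_vol {Q : AbsBlock b} (hQ : Q.carrier.Nonempty) :
    Tendsto (fun N => ∏ j ∈ Finset.range N, (Q.hi j - Q.lo j)) atTop (𝓝 Q.vol) := by
  have hne : Q.carrier ≠ ∅ := hQ.ne_empty
  rw [AbsBlock.vol, if_neg hne]
  exact (multipliable_of_summable_max_log (fun j => sub_pos.2 (Q.lt j))
    (Q.meas.resolve_left hne)).hasProd.tendsto_prod_nat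

theorem exists_coords (b : HilbertBasis ℕ ℝ E) {z : ℕ → ℝ} (hz : Summable fun j => z j ^ 2) :
    ∃ x : E, ∀ j, inner ℝ (b j) x = z j := by
  have hm : Memℓp z 2 := by
    rw [memℓp_gen_iff (by norm_num)]
    simpa using hz
  refine ⟨b.repr.symm ⟨z, hm⟩, fun j => ?_⟩
  rw [← b.repr_apply_apply, LinearIsometryEquiv.apply_symm_apply]

theorem summable_coords_sq (b : HilbertBasis ℕ ℝ E) (x : E) :
    Summable fun j => (inner ℝ (b j) x) ^ 2 := by
  have := (b.repr x).2
  have h := (memℓp_gen_iff (by norm_num)).1 this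
  simpa [b.repr_apply_apply] using h

/-- Finitely many nonempty blocks, no two of which are separated by a coordinate, have a common point
with prescribed admissible first `N` coordinates. -/
theorem exists_point (I : Finset (AbsBlock b)) (hI : I.Nonempty)
    (hne : ∀ Q ∈ I, Q.carrier.Nonempty) (N : ℕ) (p : ℕ → ℝ)
    (hp : ∀ Q ∈ I, ∀ j < N, p j ∈ Set.Ico (Q.lo j) (Q.hi j))
    (hsep : ∀ Q ∈ I, ∀ W ∈ I, ∀ j, Q.lo j < W.hi j) :
    ∃ x : E, (∀ Q ∈ I, x ∈ Q.carrier) ∧ ∀ j < N, inner ℝ (b j) x = p j := by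
  choose! v hv using hne
  have hy : ∀ j, ∃ y, (∀ Q ∈ I, y ∈ Set.Ico (Q.lo j) (Q.hi j)) ∧
      |y| ≤ ∑ Q ∈ I, |inner ℝ (b j) (v Q)| := fun j =>
    exists_common_point (x := fun Q => inner ℝ (b j) (v Q)) hI (fun Q hQ => hv Q hQ j)
      fun Q hQ W hW => hsep Q hQ W hW j
  choose y hy1 hy2 using hy
  have hys : Summable fun j => y j ^ 2 := by
    have hs : Summable fun j => (I.card : ℝ) * ∑ Q ∈ I, (inner ℝ (b j) (v Q)) ^ 2 :=
      (summable_sum fun Q _ => summable_coords_sq b (v Q)).mul_left _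
    refine Summable.of_nonneg_of_le (fun j => sq_nonneg _) (fun j => ?_) hs
    calc y j ^ 2 = |y j| ^ 2 := (sq_abs _).symm
      _ ≤ (∑ Q ∈ I, |inner ℝ (b j) (v Q)|) ^ 2 := by gcongr; exact hy2 j
      _ ≤ I.card * ∑ Q ∈ I, |inner ℝ (b j) (v Q)| ^ 2 := sq_sum_le_card_mul_sum_sq
      _ = _ := by simp only [sq_abs]
  have hzs : Summable fun j => (if j < N then p j else y j) ^ 2 := by
    rw [← summable_nat_add_iff N] at hys ⊢
    simpa using hys
  obtain ⟨x, hx⟩ := exists_coords b hzs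
  refine ⟨x, fun Q hQ j => ?_, fun j hj => by rw [hx, if_pos hj]⟩
  rw [hx]
  split_ifs with hj
  · exact hp Q hQ j hj
  · exact hy1 j Q hQ

theorem finite_dim_nonneg (s : Finset (AbsBlock b)) (c : AbsBlock b → ℝ)
    (hne : ∀ Q ∈ s, Q.carrier.Nonempty)
    (h : ∀ x, 0 ≤ ∑ Q ∈ s, c Q * Q.carrier.indicator (fun _ => (1 : ℝ)) x) (N : ℕ)
    (hN : ∀ Q ∈ s, ∀ W ∈ s, ∀ j, W.hi j ≤ Q.lo j → ∃ i < N,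
      W.hi i ≤ Q.lo i ∨ Q.hi i ≤ W.lo i) (p : ℕ → ℝ) :
    0 ≤ ∑ Q ∈ s, c Q * ∏ j ∈ Finset.range N,
      (Set.Ico (Q.lo j) (Q.hi j)).indicator (fun _ => (1 : ℝ)) (p j) := by
  classical
  set I := s.filter fun Q => ∀ j < N, p j ∈ Set.Ico (Q.lo j) (Q.hi j) with hIdef
  have hprod : ∀ Q ∈ s, ∏ j ∈ Finset.range N,
      (Set.Ico (Q.lo j) (Q.hi j)).indicator (fun _ => (1 : ℝ)) (p j) =
      if Q ∈ I then 1 else 0 := by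
    intro Q hQ
    split_ifs with hQI
    · refine Finset.prod_eq_one fun j hj => ?_
      rw [Set.indicator_of_mem ((Finset.mem_filter.1 hQI).2 j (Finset.mem_range.1 hj))]
    · have : ∃ j < N, p j ∉ Set.Ico (Q.lo j) (Q.hi j) := by
        by_contra! hcon
        exact hQI (Finset.mem_filter.2 ⟨hQ, hcon⟩)
      obtain ⟨j, hj, hpj⟩ := this
      exact Finset.prod_eq_zero (Finset.mem_range.2 hj) (Set.indicator_of_notMem hpj _)
  rcases I.eq_empty_or_nonempty with hI | hI
  · refine (Finset.sum_eq_zero fun Q hQ => ?_).ge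
    rw [hprod Q hQ, hI]; simp
  obtain ⟨x, hx1, hx2⟩ := exists_point I hI (fun Q hQ => hne Q (Finset.mem_filter.1 hQ).1) N p
    (fun Q hQ => (Finset.mem_filter.1 hQ).2) (by
      intro Q hQ W hW j
      by_contra! hcon
      rw [hIdef, Finset.mem_filter] at hQ hW
      obtain ⟨i, hi, h'⟩ := hN Q hQ.1 W hW.1 j hcon
      have hq := hQ.2 i hi
      have hw := hW.2 i hi
      rcases h' with h' | h'
      · exact absurd (hw.2.trans_le (h'.trans hq.1)) (lt_irrefl _)
      · exact absurd (hq.2.trans_le (h'.trans hw.1)) (lt_irrefl _))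
  refine (h x).trans_eq (Finset.sum_congr rfl fun Q hQ => ?_)
  rw [hprod Q hQ]
  split_ifs with hQI
  · rw [Set.indicator_of_mem (hx1 Q hQI)]
  · rw [Set.indicator_of_notMem]
    intro hx
    refine hQI (Finset.mem_filter.2 ⟨hQ, fun j hj => ?_⟩)
    rw [← hx2 j hj]
    exact hx j

theorem integral_prod_indicator (Q : AbsBlock b) (N : ℕ) :
    Integrable (fun p : Fin N → ℝ =>
      ∏ j : Fin N, (Set.Ico (Q.lo j) (Q.hi j)).indicator (fun _ => (1 : ℝ)) (p j)) ∧
    ∫ p : Fin N → ℝ, ∏ j : Fin N, (Set.Ico (Q.lo j) (Q.hi j)).indicator (fun _ => (1 : ℝ)) (p j) =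
      ∏ j ∈ Finset.range N, (Q.hi j - Q.lo j) := by
  constructor
  · refine Integrable.fintype_prod (f := fun j : Fin N =>
      (Set.Ico (Q.lo j) (Q.hi j)).indicator (fun _ => (1 : ℝ))) fun j => ?_
    rw [integrable_indicator_iff measurableSet_Ico]
    exact integrableOn_const (by simp)
  · rw [integral_fintype_prod_volume_eq_prod (f := fun j : Fin N =>
      (Set.Ico (Q.lo j) (Q.hi j)).indicator (fun _ => (1 : ℝ))), Finset.prod_range]
    refine Finset.prod_congr rfl fun j _ => ?_
    rw [integral_indicator measurableSet_Ico]
    simp [(Q.lt j).le]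

/-- The volume is consistent: a nonnegative linear combination of indicators of blocks has
nonnegative total volume, so the volume extends to a finitely additive measure. -/
theorem isPositiveContent_blocks :
    IsPositiveContent (AbsBlock.carrier (b := b)) AbsBlock.vol := by
  classical
  intro s c h
  set s' := s.filter fun Q => Q.carrier.Nonempty with hs'
  have hz : ∀ Q ∈ s, Q ∉ s' → Q.carrier = ∅ := fun Q hQ hQ' => by
    by_contra hcon
    exact hQ' (Finset.mem_filter.2 ⟨hQ, Set.nonempty_iff_ne_empty.2 hcon⟩)
  have hne : ∀ Q ∈ s', Q.carrier.Nonempty := fun Q hQ => (Finset.mem_filter.1 hQ).2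
  rw [← Finset.sum_subset (Finset.filter_subset _ s) fun Q hQ hQ' => by
    rw [AbsBlock.vol, if_pos (hz Q hQ hQ'), mul_zero]]
  have h' : ∀ x, 0 ≤ ∑ Q ∈ s', c Q * Q.carrier.indicator (fun _ => (1 : ℝ)) x := fun x => by
    rw [Finset.sum_subset (Finset.filter_subset _ s) fun Q hQ hQ' => by
      rw [hz Q hQ hQ']; simp]
    exact h x
  have hT : Tendsto (fun N => ∑ Q ∈ s', c Q * ∏ j ∈ Finset.range N, (Q.hi j - Q.lo j)) atTop
      (𝓝 (∑ Q ∈ s', c Q * Q.vol)) :=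
    tendsto_finsetSum _ fun Q hQ => (AbsBlock.tendsto_vol (hne Q hQ)).const_mul _
  refine ge_of_tendsto hT ?_
  have hsep : ∀ Q W : AbsBlock b, ∃ N : ℕ, ∀ j, W.hi j ≤ Q.lo j → ∃ i < N,
      W.hi i ≤ Q.lo i ∨ Q.hi i ≤ W.lo i := by
    intro Q W
    by_cases hex : ∃ j, W.hi j ≤ Q.lo j
    · obtain ⟨j, hj⟩ := hex
      exact ⟨j + 1, fun _ _ => ⟨j, j.lt_succ_self, Or.inl hj⟩⟩
    · exact ⟨0, fun j hj => absurd ⟨j, hj⟩ hex⟩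
  choose F hF using hsep
  refine (eventually_ge_atTop (∑ Q ∈ s', ∑ W ∈ s', F Q W)).mono fun N hN => ?_
  have hF' : ∀ Q ∈ s', ∀ W ∈ s', ∀ j, W.hi j ≤ Q.lo j → ∃ i < N,
      W.hi i ≤ Q.lo i ∨ Q.hi i ≤ W.lo i := by
    intro Q hQ W hW j hj
    obtain ⟨i, hi, h2⟩ := hF Q W j hj
    refine ⟨i, hi.trans_le (le_trans ?_ hN), h2⟩
    exact (Finset.single_le_sum (f := fun W => F Q W) (fun _ _ => Nat.zero_le _) hW).trans
      (Finset.single_le_sum (f := fun Q => ∑ W ∈ s', F Q W) (fun _ _ => Nat.zero_le _) hQ)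
  have hpt := finite_dim_nonneg s' c hne h' N hF'
  have : 0 ≤ ∫ p : Fin N → ℝ, ∑ Q ∈ s', c Q *
      ∏ j : Fin N, (Set.Ico (Q.lo j) (Q.hi j)).indicator (fun _ => (1 : ℝ)) (p j) := by
    refine integral_nonneg fun p => ?_
    have := hpt fun j => if hj : j < N then p ⟨j, hj⟩ else 0
    simpa [Finset.prod_range] using this
  rw [integral_finsetSum _ fun Q _ => (integral_prod_indicator Q N).1.const_mul _] at this
  simpa only [integral_const_mul, (integral_prod_indicator _ N).2] using this

theorem inter_carrier_mem (Q W : AbsBlock b) :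
    (Q.carrier ∩ W.carrier).indicator 1 ∈ LinearMap.range (stepFun (AbsBlock.carrier (b := b))) := by
  rcases (Q.carrier ∩ W.carrier).eq_empty_or_nonempty with he | ⟨x, hx⟩
  · rw [he, Set.indicator_empty']; exact zero_mem _
  have hQ := Q.meas.resolve_left (Set.nonempty_iff_ne_empty.1 ⟨x, hx.1⟩)
  let V : AbsBlock b :=
    { lo := fun j => max (Q.lo j) (W.lo j)
      hi := fun j => min (Q.hi j) (W.hi j)
      lo_bdd := by
        obtain ⟨C, hC⟩ := Q.lo_bdd
        obtain ⟨D, hD⟩ := W.lo_bdd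
        exact ⟨max C D, fun j => abs_max_le_max_abs_abs.trans (max_le_max (hC j) (hD j))⟩
      hi_bdd := by
        obtain ⟨C, hC⟩ := Q.hi_bdd
        obtain ⟨D, hD⟩ := W.hi_bdd
        exact ⟨max C D, fun j => abs_min_le_max_abs_abs.trans (max_le_max (hC j) (hD j))⟩
      lt := fun j => lt_of_le_of_lt (max_le (hx.1 j).1 (hx.2 j).1) (lt_min (hx.1 j).2 (hx.2 j).2)
      meas := by
        refine Or.inr (Summable.of_nonneg_of_le (fun j => le_max_left _ _) (fun j => ?_) hQ)
        have h1 : 0 < min (Q.hi j) (W.hi j) - max (Q.lo j) (W.lo j) :=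
          sub_pos.2 (lt_of_le_of_lt (max_le (hx.1 j).1 (hx.2 j).1)
            (lt_min (hx.1 j).2 (hx.2 j).2))
        refine max_le_max le_rfl (Real.log_le_log h1 ?_)
        exact sub_le_sub (min_le_left _ _) (le_max_left _ _) }
  have : Q.carrier ∩ W.carrier = V.carrier := by
    ext y
    simp only [AbsBlock.carrier, box, Set.mem_inter_iff, Set.mem_ofPred_eq, Set.mem_Ico, V, max_le_iff,
      lt_min_iff]
    constructor
    · rintro ⟨h1, h2⟩ j
      exact ⟨⟨(h1 j).1, (h2 j).1⟩, (h1 j).2, (h2 j).2⟩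
    · intro h
      exact ⟨fun j => ⟨(h j).1.1, (h j).2.1⟩, fun j => ⟨(h j).1.2, (h j).2.2⟩⟩
  rw [this]
  exact indicator_mem_range _ V

/-- The minimal ring of subsets of `E` that contains all absolutely measurable blocks. -/
def blockRing (b : HilbertBasis ℕ ℝ E) : Set (Set E) :=
  {A | ∀ R : Set (Set E), IsSetRing R → (∀ Q : AbsBlock b, Q.carrier ∈ R) → A ∈ R}

/-- The finitely additive extension of the volume of blocks to the minimal ring
(`ringVol_carrier`, `ringVol_union`, `ringVol_nonneg`). -/
def ringVol (b : HilbertBasis ℕ ℝ E) (A : Set E) : ℝ :=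
  (stepIntegral (AbsBlock.carrier (b := b)) AbsBlock.vol (A.indicator 1)).re

theorem isSetRing_blockRing (b : HilbertBasis ℕ ℝ E) : IsSetRing (blockRing b) where
  empty_mem := fun _ hR _ => hR.empty_mem
  union_mem := fun _ _ hs ht R hR hQ => hR.union_mem (hs R hR hQ) (ht R hR hQ)
  sdiff_mem := fun _ _ hs ht R hR hQ => hR.sdiff_mem (hs R hR hQ) (ht R hR hQ)

theorem carrier_mem_blockRing (Q : AbsBlock b) : Q.carrier ∈ blockRing b := fun _ _ hQ => hQ Q

theorem blockRing_induction {P : Set E → Prop} (h0 : P ∅) (hQ : ∀ Q : AbsBlock b, P Q.carrier)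
    (hu : ∀ A B, P A → P B → P (A ∪ B)) (hd : ∀ A B, P A → P B → P (A \ B)) {A : Set E}
    (hA : A ∈ blockRing b) : P A :=
  hA {A | P A} ⟨h0, fun _ _ => hu _ _, fun _ _ => hd _ _⟩ hQ

theorem blockRing_indicator_mem {A : Set E} (hA : A ∈ blockRing b) :
    A.indicator 1 ∈ LinearMap.range (stepFun (AbsBlock.carrier (b := b))) := by
  have hm : ∀ A B : Set E,
      A.indicator 1 ∈ LinearMap.range (stepFun (AbsBlock.carrier (b := b))) →
      B.indicator 1 ∈ LinearMap.range (stepFun (AbsBlock.carrier (b := b))) →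
      A.indicator 1 * B.indicator 1 ∈ LinearMap.range (stepFun (AbsBlock.carrier (b := b))) :=
    fun A B hA hB => mul_mem_range inter_carrier_mem hA hB
  refine blockRing_induction (b := b)
    (P := fun A => A.indicator 1 ∈ LinearMap.range (stepFun (AbsBlock.carrier (b := b))))
    (by rw [Set.indicator_empty']; exact zero_mem _) (indicator_mem_range _) (fun A B hA hB => ?_) (fun A B hA hB => ?_) hA
  · have : (A ∪ B).indicator (1 : E → ℂ) =
        A.indicator 1 + B.indicator 1 - A.indicator 1 * B.indicator 1 := by
      funext x
      by_cases h : x ∈ A <;> by_cases h' : x ∈ B <;> simp [h, h']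
    rw [this]
    exact sub_mem (add_mem hA hB) (hm A B hA hB)
  · have : (A \ B).indicator (1 : E → ℂ) = A.indicator 1 - A.indicator 1 * B.indicator 1 := by
      funext x
      by_cases h : x ∈ A <;> by_cases h' : x ∈ B <;> simp [h, h']
    rw [this]
    exact sub_mem hA (hm A B hA hB)

theorem ringVol_carrier (Q : AbsBlock b) : ringVol b Q.carrier = Q.vol := by
  rw [ringVol, stepIntegral_indicator isPositiveContent_blocks, Complex.ofReal_re]

theorem ringVol_nonneg {A : Set E} (hA : A ∈ blockRing b) : 0 ≤ ringVol b A :=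
  stepIntegral_re_nonneg isPositiveContent_blocks (blockRing_indicator_mem hA) fun x => by
    by_cases h : x ∈ A <;> simp [h]

theorem ringVol_union {A B : Set E} (hA : A ∈ blockRing b) (hB : B ∈ blockRing b)
    (h : Disjoint A B) : ringVol b (A ∪ B) = ringVol b A + ringVol b B := by
  have : (A ∪ B).indicator (1 : E → ℂ) = A.indicator 1 + B.indicator 1 :=
    Set.indicator_union_of_disjoint h _
  rw [ringVol, this, stepIntegral_add isPositiveContent_blocks (blockRing_indicator_mem hA)
    (blockRing_indicator_mem hB), Complex.add_re, ringVol, ringVol]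

theorem ringVol_sdiff {A B : Set E} (hA : A ∈ blockRing b) (hB : B ∈ blockRing b) (h : A ⊆ B) :
    ringVol b (B \ A) = ringVol b B - ringVol b A := by
  have := ringVol_union hA ((isSetRing_blockRing b).sdiff_mem hB hA) Set.disjoint_sdiff_right
  rw [Set.union_sdiff_cancel h] at this
  linarith

theorem ringVol_mono {A B : Set E} (hA : A ∈ blockRing b) (hB : B ∈ blockRing b) (h : A ⊆ B) :
    ringVol b A ≤ ringVol b B := by
  have := ringVol_nonneg ((isSetRing_blockRing b).sdiff_mem hB hA)
  rw [ringVol_sdiff hA hB h] at this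
  linarith

theorem isPositiveContent_blockRing :
    IsPositiveContent (fun A : blockRing b => (A : Set E)) (fun A => ringVol b A) := by
  intro s c h
  have hP := isPositiveContent_blocks (b := b)
  have key : ∀ s : Finset (blockRing b),
      (∑ A ∈ s, (c A : ℂ) • (A : Set E).indicator (1 : E → ℂ)) ∈
        LinearMap.range (stepFun (AbsBlock.carrier (b := b))) ∧
      (stepIntegral (AbsBlock.carrier (b := b)) AbsBlock.vol
        (∑ A ∈ s, (c A : ℂ) • (A : Set E).indicator (1 : E → ℂ))).re =
        ∑ A ∈ s, c A * ringVol b A := by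
    classical
    intro s
    induction s using Finset.induction_on with
    | empty =>
      refine ⟨by simp, ?_⟩
      have := stepIntegral_smul hP 0 (zero_mem (LinearMap.range (stepFun _)))
      rw [zero_smul, zero_mul] at this
      rw [Finset.sum_empty, Finset.sum_empty, this, Complex.zero_re]
    | insert A s hA ih =>
      have h1 : (c A : ℂ) • (A : Set E).indicator (1 : E → ℂ) ∈
          LinearMap.range (stepFun (AbsBlock.carrier (b := b))) :=
        Submodule.smul_mem _ _ (blockRing_indicator_mem A.2)
      rw [Finset.sum_insert hA, Finset.sum_insert hA]
      refine ⟨add_mem h1 ih.1, ?_⟩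
      rw [stepIntegral_add hP h1 ih.1, Complex.add_re, ih.2,
        stepIntegral_smul hP _ (blockRing_indicator_mem A.2), Complex.re_ofReal_mul, ringVol]
  rw [← (key s).2]
  refine stepIntegral_re_nonneg hP (key s).1 fun x => ?_
  convert h x using 1
  rw [Finset.sum_apply, Complex.re_sum]
  refine Finset.sum_congr rfl fun A _ => ?_
  exact (indicator_re_im (A : Set E) x (c A)).1

end Blocks

section Completion

variable {E : Type*} [NormedAddCommGroup E] [InnerProductSpace ℝ E]

/-- The completion of the minimal ring: sets enclosed between two members of the ring whose
difference has arbitrarily small volume. -/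
def completedRing (b : HilbertBasis ℕ ℝ E) : Set (Set E) :=
  {B | ∀ ε > 0, ∃ A₁ ∈ blockRing b, ∃ A₂ ∈ blockRing b,
    A₁ ⊆ B ∧ B ⊆ A₂ ∧ ringVol b (A₂ \ A₁) < ε}

/-- The shift-invariant finitely additive measure on the completed ring (the outer value, which on
the completed ring is also the inner one, see `lam_le` and `le_lam`). -/
def lam (b : HilbertBasis ℕ ℝ E) (B : Set E) : ℝ :=
  sInf (ringVol b '' {A | A ∈ blockRing b ∧ B ⊆ A})

variable {b : HilbertBasis ℕ ℝ E}

theorem lam_le {A B : Set E} (hA : A ∈ blockRing b) (h : B ⊆ A) : lam b B ≤ ringVol b A := by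
  refine csInf_le ⟨0, ?_⟩ ⟨A, ⟨hA, h⟩, rfl⟩
  rintro _ ⟨A', hA', rfl⟩
  exact ringVol_nonneg hA'.1

theorem le_lam {A B : Set E} (hA : A ∈ blockRing b) (h : A ⊆ B) (hB : B ∈ completedRing b) :
    ringVol b A ≤ lam b B := by
  obtain ⟨_, _, A₂, hA₂, _, h2, _⟩ := hB 1 one_pos
  refine le_csInf ⟨_, A₂, ⟨hA₂, h2⟩, rfl⟩ ?_
  rintro _ ⟨A', hA', rfl⟩
  exact ringVol_mono hA hA'.1 (h.trans hA'.2)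

theorem blockRing_subset_completedRing {A : Set E} (hA : A ∈ blockRing b) :
    A ∈ completedRing b := fun ε hε => by
  refine ⟨A, hA, A, hA, subset_rfl, subset_rfl, ?_⟩
  rwa [ringVol_sdiff hA hA subset_rfl, sub_self]

theorem lam_eq_ringVol {A : Set E} (hA : A ∈ blockRing b) : lam b A = ringVol b A :=
  le_antisymm (lam_le hA subset_rfl)
    (le_lam hA subset_rfl (blockRing_subset_completedRing hA))

/-- `lam` extends the volume of blocks. -/
theorem lam_carrier (Q : AbsBlock b) : lam b Q.carrier = Q.vol := by
  rw [lam_eq_ringVol (carrier_mem_blockRing Q), ringVol_carrier]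

theorem isPositiveContent_completedRing :
    IsPositiveContent (fun B : completedRing b => (B : Set E)) (fun B => lam b B) := by
  classical
  intro s c h
  refine le_of_forall_pos_le_add fun ε hε => ?_
  set K : ℝ := ∑ B ∈ s, |c B| with hK
  have hK0 : 0 ≤ K := Finset.sum_nonneg fun _ _ => abs_nonneg _
  have hδ : 0 < ε / (K + 1) := by positivity
  have hap : ∀ B : completedRing b, ∃ A : blockRing b,
      (∀ x, c B * (B : Set E).indicator (fun _ => (1 : ℝ)) x ≤
        c B * (A : Set E).indicator (fun _ => (1 : ℝ)) x) ∧
      c B * ringVol b A ≤ c B * lam b B + |c B| * (ε / (K + 1)) := by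
    intro B
    obtain ⟨A₁, hA₁, A₂, hA₂, h1, h2, h3⟩ := B.2 _ hδ
    rw [ringVol_sdiff hA₁ hA₂ (h1.trans h2)] at h3
    have h4 := le_lam hA₁ h1 B.2
    have h5 := lam_le hA₂ h2
    rcases le_total 0 (c B) with hc | hc
    · refine ⟨⟨A₂, hA₂⟩, fun x => mul_le_mul_of_nonneg_left
        (Set.indicator_le_indicator_of_subset h2 (fun _ => zero_le_one) x) hc, ?_⟩
      rw [abs_of_nonneg hc, ← mul_add]
      exact mul_le_mul_of_nonneg_left (by linarith) hc
    · refine ⟨⟨A₁, hA₁⟩, fun x => mul_le_mul_of_nonpos_left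
        (Set.indicator_le_indicator_of_subset h1 (fun _ => zero_le_one) x) hc, ?_⟩
      rw [abs_of_nonpos hc, neg_mul, ← mul_neg, ← mul_add]
      exact mul_le_mul_of_nonpos_left (by linarith) hc
  choose F hF1 hF2 using hap
  have hsum : 0 ≤ ∑ B ∈ s, c B * ringVol b (F B) := by
    have key := isPositiveContent_blockRing (b := b) (s.image F)
      (fun A => ∑ B ∈ s with F B = A, c B) fun x => by
        refine (h x).trans ((Finset.sum_le_sum fun B _ => hF1 B x).trans_eq ?_)
        rw [← Finset.sum_fiberwise_of_maps_to
          (fun B hB => Finset.mem_image_of_mem F hB)]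
        refine Finset.sum_congr rfl fun A _ => ?_
        rw [Finset.sum_mul]
        refine Finset.sum_congr rfl fun B hB => ?_
        rw [(Finset.mem_filter.1 hB).2]
    refine key.trans_eq ?_
    rw [← Finset.sum_fiberwise_of_maps_to (s := s) (t := s.image F) (g := F)
      (fun B hB => Finset.mem_image_of_mem F hB)]
    refine Finset.sum_congr rfl fun A _ => ?_
    rw [Finset.sum_mul]
    refine Finset.sum_congr rfl fun B hB => ?_
    rw [(Finset.mem_filter.1 hB).2]
  calc (0 : ℝ) ≤ ∑ B ∈ s, c B * ringVol b (F B) := hsum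
    _ ≤ ∑ B ∈ s, (c B * lam b B + |c B| * (ε / (K + 1))) := Finset.sum_le_sum fun B _ => hF2 B
    _ = ∑ B ∈ s, c B * lam b B + K * (ε / (K + 1)) := by
      rw [Finset.sum_add_distrib, ← Finset.sum_mul]
    _ ≤ ∑ B ∈ s, c B * lam b B + ε := by
      gcongr
      rw [mul_div_assoc', div_le_iff₀ (by positivity)]
      nlinarith

theorem inter_mem_completedRing {B C : Set E} (hB : B ∈ completedRing b)
    (hC : C ∈ completedRing b) : B ∩ C ∈ completedRing b := fun ε hε => by
  have hR := isSetRing_blockRing b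
  obtain ⟨A₁, hA₁, A₂, hA₂, h1, h2, h3⟩ := hB (ε / 2) (by positivity)
  obtain ⟨D₁, hD₁, D₂, hD₂, k1, k2, k3⟩ := hC (ε / 2) (by positivity)
  have hX := hR.sdiff_mem hA₂ hA₁
  have hY := hR.sdiff_mem hD₂ hD₁
  refine ⟨_, hR.inter_mem hA₁ hD₁, _, hR.inter_mem hA₂ hD₂, Set.inter_subset_inter h1 k1,
    Set.inter_subset_inter h2 k2, ?_⟩
  have hsub : (A₂ ∩ D₂) \ (A₁ ∩ D₁) ⊆ (A₂ \ A₁) ∪ ((D₂ \ D₁) \ (A₂ \ A₁)) := by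
    intro x hx
    by_cases h : x ∈ A₁
    · exact Or.inr ⟨⟨hx.1.2, fun h' => hx.2 ⟨h, h'⟩⟩, fun h' => h'.2 h⟩
    · exact Or.inl ⟨hx.1.1, h⟩
  have hYX := hR.sdiff_mem hY hX
  calc _ ≤ ringVol b ((A₂ \ A₁) ∪ ((D₂ \ D₁) \ (A₂ \ A₁))) :=
        ringVol_mono (hR.sdiff_mem (hR.inter_mem hA₂ hD₂) (hR.inter_mem hA₁ hD₁))
          (hR.union_mem hX hYX) hsub
    _ = ringVol b (A₂ \ A₁) + ringVol b ((D₂ \ D₁) \ (A₂ \ A₁)) :=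
        ringVol_union hX hYX Set.disjoint_sdiff_right
    _ ≤ ringVol b (A₂ \ A₁) + ringVol b (D₂ \ D₁) := by
        gcongr
        exact ringVol_mono hYX hY Set.sdiff_subset
    _ < ε := by linarith

/-- The translate of a block by `h`. -/
def AbsBlock.shift (h : E) (Q : AbsBlock b) : AbsBlock b where
  lo j := Q.lo j + inner ℝ (b j) h
  hi j := Q.hi j + inner ℝ (b j) h
  lo_bdd := by
    obtain ⟨C, hC⟩ := Q.lo_bdd
    refine ⟨C + ‖h‖, fun j => (abs_add_le _ _).trans (add_le_add (hC j) ?_)⟩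
    simpa [b.orthonormal.1 j] using abs_real_inner_le_norm (b j) h
  hi_bdd := by
    obtain ⟨C, hC⟩ := Q.hi_bdd
    refine ⟨C + ‖h‖, fun j => (abs_add_le _ _).trans (add_le_add (hC j) ?_)⟩
    simpa [b.orthonormal.1 j] using abs_real_inner_le_norm (b j) h
  lt j := by linarith [Q.lt j]
  meas := by
    rcases Q.meas with hQ | hQ
    · left
      rw [Set.eq_empty_iff_forall_notMem] at hQ ⊢
      refine fun x hx => hQ (x - h) fun j => ?_
      have := hx j
      rw [inner_sub_right]
      exact ⟨by linarith [this.1], by linarith [this.2]⟩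
    · right
      simpa using hQ

theorem AbsBlock.shift_carrier (h : E) (Q : AbsBlock b) :
    (Q.shift h).carrier = (fun x => x - h) ⁻¹' Q.carrier := by
  ext x
  simp only [AbsBlock.carrier, box, AbsBlock.shift, Set.mem_preimage, Set.mem_ofPred_eq, Set.mem_Ico,
    inner_sub_right, le_sub_iff_add_le, sub_lt_iff_lt_add]

theorem AbsBlock.shift_vol (h : E) (Q : AbsBlock b) : (Q.shift h).vol = Q.vol := by
  have : (Q.shift h).carrier = ∅ ↔ Q.carrier = ∅ := by
    rw [AbsBlock.shift_carrier, Set.preimage_eq_empty_iff,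
      (show Function.Surjective fun x : E => x - h from fun y => ⟨y + h, by simp⟩).range_eq,
      Set.disjoint_univ]
  simp only [AbsBlock.vol, this]
  simp [AbsBlock.shift]

theorem shift_mem_blockRing (h : E) {A : Set E} (hA : A ∈ blockRing b) :
    (fun x => x - h) ⁻¹' A ∈ blockRing b := by
  have hR := isSetRing_blockRing b
  refine blockRing_induction (b := b) (P := fun A => (fun x => x - h) ⁻¹' A ∈ blockRing b)
    hR.empty_mem (fun Q => ?_) (fun A B hA hB => hR.union_mem hA hB)
    (fun A B hA hB => hR.sdiff_mem hA hB) hA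
  rw [← AbsBlock.shift_carrier]
  exact carrier_mem_blockRing _

theorem ringVol_shift (h : E) {A : Set E} (hA : A ∈ blockRing b) :
    ringVol b ((fun x => x - h) ⁻¹' A) = ringVol b A := by
  rw [ringVol, ringVol, ← stepIntegral_comp isPositiveContent_blocks (AbsBlock.shift_carrier h)
    (AbsBlock.shift_vol h) (blockRing_indicator_mem hA)]
  rfl

theorem shift_mem_completedRing (h : E) {B : Set E} (hB : B ∈ completedRing b) :
    (fun x => x - h) ⁻¹' B ∈ completedRing b := fun ε hε => by
  obtain ⟨A₁, hA₁, A₂, hA₂, h1, h2, h3⟩ := hB ε hε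
  refine ⟨_, shift_mem_blockRing h hA₁, _, shift_mem_blockRing h hA₂, Set.preimage_mono h1,
    Set.preimage_mono h2, ?_⟩
  rw [← Set.preimage_sdiff, ringVol_shift h ((isSetRing_blockRing b).sdiff_mem hA₂ hA₁)]
  exact h3

theorem lam_shift (h : E) (B : Set E) : lam b ((fun x => x - h) ⁻¹' B) = lam b B := by
  have key : ∀ (h : E) (B : Set E), ringVol b '' {A | A ∈ blockRing b ∧ B ⊆ A} ⊆
      ringVol b '' {A | A ∈ blockRing b ∧ (fun x => x - h) ⁻¹' B ⊆ A} := by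
    rintro h B _ ⟨A, ⟨hA, hBA⟩, rfl⟩
    exact ⟨_, ⟨shift_mem_blockRing h hA, Set.preimage_mono hBA⟩, ringVol_shift h hA⟩
  have hback : (fun x => x - (-h)) ⁻¹' ((fun x => x - h) ⁻¹' B) = B := by
    ext x; simp
  rw [lam, lam]
  congr 1
  refine Set.Subset.antisymm ?_ (key h B)
  have := key (-h) ((fun x => x - h) ⁻¹' B)
  rwa [hback] at this

end Completion

section Space

variable {E : Type*} [NormedAddCommGroup E] [InnerProductSpace ℝ E]

/-- Simple functions: linear combinations of indicators of sets of the completed ring. -/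
def simpleFns (b : HilbertBasis ℕ ℝ E) : Submodule ℂ (E → ℂ) :=
  Submodule.span ℂ {f | ∃ B ∈ completedRing b, f = B.indicator 1}

/-- The integral of simple functions: `∑ c_k 1_{B_k} ↦ ∑ c_k λ(B_k)`. -/
def simpleIntegral (b : HilbertBasis ℕ ℝ E) (f : E → ℂ) : ℂ :=
  stepIntegral (fun B : completedRing b => (B : Set E)) (fun B => lam b B) f

variable {b : HilbertBasis ℕ ℝ E}

theorem simpleFns_eq_range :
    simpleFns b = LinearMap.range (stepFun fun B : completedRing b => (B : Set E)) := by
  rw [stepFun, Finsupp.range_linearCombination, simpleFns]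
  congr 1
  ext f
  constructor
  · rintro ⟨B, hB, rfl⟩; exact ⟨⟨B, hB⟩, rfl⟩
  · rintro ⟨B, rfl⟩; exact ⟨B, B.2, rfl⟩

theorem conj_mul_mem_simpleFns {f g : E → ℂ} (hf : f ∈ simpleFns b) (hg : g ∈ simpleFns b) :
    (fun x => conj (f x) * g x) ∈ simpleFns b := by
  rw [simpleFns_eq_range] at *
  have hcf : (fun x => conj (f x)) ∈
      LinearMap.range (stepFun fun B : completedRing b => (B : Set E)) := by
    obtain ⟨c, rfl⟩ := hf
    exact ⟨_, (conj_stepFun _ c).symm⟩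
  exact mul_mem_range (A := fun B : completedRing b => (B : Set E))
    (fun B C => indicator_mem_range (fun B : completedRing b => (B : Set E))
      ⟨B ∩ C, inter_mem_completedRing B.2 C.2⟩) hcf hg

theorem comp_shift_mem_simpleFns (h : E) {f : E → ℂ} (hf : f ∈ simpleFns b) :
    (fun x => f (x - h)) ∈ simpleFns b := by
  rw [simpleFns_eq_range] at *
  exact comp_mem_range (σ := fun B : completedRing b => ⟨_, shift_mem_completedRing h B.2⟩)
    (φ := fun x => x - h) (fun _ => rfl) hf

theorem simpleIntegral_add {f g : E → ℂ} (hf : f ∈ simpleFns b) (hg : g ∈ simpleFns b) :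
    simpleIntegral b (fun x => f x + g x) = simpleIntegral b f + simpleIntegral b g := by
  rw [simpleFns_eq_range] at *
  exact stepIntegral_add isPositiveContent_completedRing hf hg

theorem simpleIntegral_smul (z : ℂ) {f : E → ℂ} (hf : f ∈ simpleFns b) :
    simpleIntegral b (fun x => z * f x) = z * simpleIntegral b f := by
  rw [simpleFns_eq_range] at *
  exact stepIntegral_smul isPositiveContent_completedRing z hf

theorem simpleIntegral_conj {f : E → ℂ} (hf : f ∈ simpleFns b) :
    simpleIntegral b (fun x => conj (f x)) = conj (simpleIntegral b f) := by
  rw [simpleFns_eq_range] at *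
  exact stepIntegral_conj isPositiveContent_completedRing hf

theorem simpleIntegral_re_nonneg {f : E → ℂ} (hf : f ∈ simpleFns b) (h : ∀ x, 0 ≤ (f x).re) :
    0 ≤ (simpleIntegral b f).re := by
  rw [simpleFns_eq_range] at *
  exact stepIntegral_re_nonneg isPositiveContent_completedRing hf h

theorem simpleIntegral_shift (h : E) {f : E → ℂ} (hf : f ∈ simpleFns b) :
    simpleIntegral b (fun x => f (x - h)) = simpleIntegral b f := by
  rw [simpleFns_eq_range] at *
  exact stepIntegral_comp isPositiveContent_completedRing
    (σ := fun B : completedRing b => ⟨_, shift_mem_completedRing h B.2⟩)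
    (φ := fun x => x - h) (fun _ => rfl) (fun B => lam_shift h B) hf

theorem simpleIntegral_indicator {B : Set E} (hB : B ∈ completedRing b) :
    simpleIntegral b (B.indicator 1) = lam b B :=
  stepIntegral_indicator isPositiveContent_completedRing ⟨B, hB⟩

/-- The space of simple functions with the semi-inner product `∫ conj f · g dλ`. -/
def SimpleFn (b : HilbertBasis ℕ ℝ E) : Type _ := simpleFns b

instance : AddCommGroup (SimpleFn b) := inferInstanceAs (AddCommGroup (simpleFns b))

instance : Module ℂ (SimpleFn b) := inferInstanceAs (Module ℂ (simpleFns b))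

instance simpleCore (b : HilbertBasis ℕ ℝ E) : PreInnerProductSpace.Core ℂ (SimpleFn b) where
  inner f g := simpleIntegral b fun x => conj (f.1 x) * g.1 x
  conj_inner_symm f g := by
    rw [← simpleIntegral_conj (conj_mul_mem_simpleFns g.2 f.2)]
    congr 1
    funext x
    simp [mul_comm]
  re_inner_nonneg f := simpleIntegral_re_nonneg (conj_mul_mem_simpleFns f.2 f.2) fun x => by
    rw [← Complex.normSq_eq_conj_mul_self, Complex.ofReal_re]
    exact Complex.normSq_nonneg _
  add_left f g k := by
    rw [← simpleIntegral_add (conj_mul_mem_simpleFns f.2 k.2) (conj_mul_mem_simpleFns g.2 k.2)]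
    congr 1
    funext x
    have : (f + g).1 x = f.1 x + g.1 x := rfl
    rw [this, map_add, add_mul]
  smul_left f g z := by
    rw [← simpleIntegral_smul _ (conj_mul_mem_simpleFns f.2 g.2)]
    congr 1
    funext x
    have : (z • f).1 x = z * f.1 x := rfl
    rw [this, map_mul, mul_assoc]

instance : SeminormedAddCommGroup (SimpleFn b) :=
  InnerProductSpace.Core.toSeminormedAddCommGroup (𝕜 := ℂ)

instance : InnerProductSpace ℂ (SimpleFn b) := InnerProductSpace.ofCore (simpleCore b)

/-- The indicator of a set of the completed ring as a simple function. -/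
def SimpleFn.ind (B : completedRing b) : SimpleFn b :=
  ⟨(B : Set E).indicator 1, Submodule.subset_span ⟨B, B.2, rfl⟩⟩

theorem SimpleFn.inner_def (f g : SimpleFn b) :
    inner ℂ f g = simpleIntegral b fun x => conj (f.1 x) * g.1 x := rfl

theorem SimpleFn.inner_ind (B C : completedRing b) :
    inner ℂ (SimpleFn.ind B) (SimpleFn.ind C) = (lam b (B ∩ C : Set E) : ℂ) := by
  rw [SimpleFn.inner_def, ← simpleIntegral_indicator (inter_mem_completedRing B.2 C.2)]
  congr 1
  funext x
  by_cases h : x ∈ (B : Set E) <;> by_cases h' : x ∈ (C : Set E) <;> simp [SimpleFn.ind, h, h']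

/-- The Hilbert space of square integrable functions: the Hausdorff completion of the simple
functions in the seminorm `(∫ |f|² dλ)^{1/2}` (null functions are identified with `0`). -/
abbrev HE (b : HilbertBasis ℕ ℝ E) : Type _ := UniformSpace.Completion (SimpleFn b)

/-- The shift `f ↦ f(· - h)` on simple functions, an isometry. -/
def simpleShift (b : HilbertBasis ℕ ℝ E) (h : E) : SimpleFn b →ₗᵢ[ℂ] SimpleFn b :=
  LinearMap.isometryOfInner
    { toFun := fun f => ⟨fun x => f.1 (x - h), comp_shift_mem_simpleFns h f.2⟩
      map_add' := fun _ _ => rfl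
      map_smul' := fun _ _ => rfl }
    fun f g => simpleIntegral_shift h (conj_mul_mem_simpleFns f.2 g.2)

/-- The shift operator `S_h f(x) = f(x - h)` on `HE b`, the continuous extension from simple functions. -/
def shift (b : HilbertBasis ℕ ℝ E) (h : E) : HE b →L[ℂ] HE b :=
  (simpleShift b h).toContinuousLinearMap.completion

theorem shift_coe (h : E) (f : SimpleFn b) :
    shift b h (f : HE b) = (simpleShift b h f : HE b) :=
  ContinuousLinearMap.completion_apply_coe _ _

end Space

section Averaging

variable {E : Type*} [NormedAddCommGroup E] [InnerProductSpace ℝ E]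

/-- Nuclear operators: `T x = ∑ φ_n(x) y_n` with `∑ ‖φ_n‖ ‖y_n‖ < ∞`. -/
def IsNuclear (T : E →L[ℝ] E) : Prop :=
  ∃ (φ : ℕ → StrongDual ℝ E) (y : ℕ → E),
    Summable (fun n => ‖φ n‖ * ‖y n‖) ∧ ∀ x, HasSum (fun n => φ n x • y n) (T x)

/-- The orthogonal projection on the first `n` coordinates. -/
def coordProj (b : HilbertBasis ℕ ℝ E) (n : ℕ) : E →L[ℝ] E :=
  ∑ k ∈ Finset.range n, (innerSL ℝ (b k)).smulRight (b k)

/-- `ν` is a Borel probability measure with Fourier transform `ξ ↦ exp(-(Dξ, ξ)/2)`. -/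
def IsCenteredGaussian [MeasurableSpace E] (ν : Measure E) (D : E →L[ℝ] E) : Prop :=
  IsProbabilityMeasure ν ∧ ∀ ξ, charFun ν ξ = Complex.exp (-(inner ℝ (D ξ) ξ : ℝ) / 2)

open Classical in
/-- The centred Gaussian measure with covariance operator `D`. It exists for the diagonal nonnegative
operators with summable eigenvalues (`gaussianMeasure_spec`), and is determined by its Fourier
transform (`MeasureTheory.Measure.ext_of_charFun`). -/
def gaussianMeasure [MeasurableSpace E] (D : E →L[ℝ] E) : Measure E :=
  if h : ∃ ν : Measure E, IsCenteredGaussian ν D then h.choose else 0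

theorem IsNuclear.summable_eigenvalues {D : E →L[ℝ] E} (hD : IsNuclear D)
    (b : HilbertBasis ℕ ℝ E) {d : ℕ → ℝ} (hd : ∀ k, 0 ≤ d k) (hb : ∀ k, D (b k) = d k • b k) :
    Summable d := by
  obtain ⟨φ, y, hs, hsum⟩ := hD
  have hdk : ∀ k, HasSum (fun n => φ n (b k) * inner ℝ (b k) (y n)) (d k) := fun k => by
    have h1 := (hsum (b k)).mapL (innerSL ℝ (b k))
    have h2 : innerSL ℝ (b k) (D (b k)) = d k := by
      rw [hb k]
      simp [b.orthonormal.1 k]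
    rw [h2] at h1
    simpa using h1
  refine summable_of_sum_le hd (c := ∑' n, ‖φ n‖ * ‖y n‖) fun s => ?_
  have hsum' := hasSum_sum fun k (_ : k ∈ s) => hdk k
  rw [← hsum'.tsum_eq]
  refine hsum'.summable.tsum_le_tsum (fun n => ?_) hs
  have hP : ∀ k ∈ s, φ n (b k) * inner ℝ (b k) (y n) = φ n ((inner ℝ (b k) (y n) : ℝ) • b k) :=
    fun k _ => by rw [map_smul, smul_eq_mul, mul_comm]
  rw [Finset.sum_congr rfl hP, ← map_sum]
  refine (le_abs_self _).trans ((φ n).le_opNorm _ |>.trans ?_)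
  gcongr
  have hn : ‖∑ k ∈ s, (inner ℝ (b k) (y n) : ℝ) • b k‖ ^ 2 ≤ ‖y n‖ ^ 2 := by
    refine le_trans (le_of_eq ?_) (b.orthonormal.sum_inner_products_le (y n) (s := s))
    rw [← real_inner_self_eq_norm_sq, b.orthonormal.inner_sum]
    refine Finset.sum_congr rfl fun k _ => ?_
    rw [Real.norm_eq_abs, sq_abs, sq]
    rfl
  exact (sq_le_sq₀ (norm_nonneg _) (norm_nonneg _)).1 hn

theorem integral_exp_coords (v : ℕ → NNReal) (ξ : ℕ → ℝ) (N : ℕ) :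
    ∫ ω : ℕ → ℝ, Complex.exp ((∑ k ∈ Finset.range N, ω k * ξ k : ℝ) * Complex.I)
      ∂(Measure.infinitePi fun k => ProbabilityTheory.gaussianReal 0 (v k)) =
    Complex.exp (-(∑ k ∈ Finset.range N, (v k : ℝ) * ξ k ^ 2 : ℝ) / 2) := by
  have h := integral_restrict_infinitePi (μ := fun k => ProbabilityTheory.gaussianReal 0 (v k))
    (s := Finset.range N)
    (f := fun p : Finset.range N → ℝ => ∏ k, Complex.exp ((p k * ξ k : ℝ) * Complex.I))
    (Continuous.aestronglyMeasurable (by fun_prop))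
  have h1 : ∀ ω : ℕ → ℝ, Complex.exp ((∑ k ∈ Finset.range N, ω k * ξ k : ℝ) * Complex.I) =
      ∏ k : Finset.range N, Complex.exp (((Finset.range N).restrict ω k * ξ k : ℝ) * Complex.I) := by
    intro ω
    rw [← Complex.exp_sum]
    congr 1
    rw [Complex.ofReal_sum, Finset.sum_mul, ← Finset.sum_coe_sort]
    rfl
  simp_rw [h1]
  rw [h, integral_fintype_prod_eq_prod (f := fun (k : Finset.range N) (x : ℝ) =>
    Complex.exp ((x * ξ k : ℝ) * Complex.I))]
  have h2 : ∀ k : Finset.range N, ∫ x : ℝ, Complex.exp ((x * ξ k : ℝ) * Complex.I)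
      ∂(ProbabilityTheory.gaussianReal 0 (v k)) =
      Complex.exp (-((v k : ℝ) * ξ k ^ 2 : ℝ) / 2) := by
    intro k
    have := ProbabilityTheory.charFun_gaussianReal (μ := 0) (v := v k) (ξ k)
    rw [charFun_apply_real] at this
    refine Eq.trans ?_ (this.trans ?_)
    · congr 1
      funext x
      congr 1
      push_cast
      ring
    · congr 1
      push_cast
      ring
  simp_rw [h2]
  rw [← Complex.exp_sum]
  congr 1
  rw [Complex.ofReal_sum, ← Finset.sum_neg_distrib, Finset.sum_div]
  exact Finset.sum_coe_sort (Finset.range N) fun k => -(((v k : ℝ) * ξ k ^ 2 : ℝ) : ℂ) / 2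

theorem ae_summable_sq {d : ℕ → ℝ} (hd : ∀ k, 0 ≤ d k) (hs : Summable d) :
    ∀ᵐ ω : ℕ → ℝ ∂(Measure.infinitePi fun k => ProbabilityTheory.gaussianReal 0 (d k).toNNReal),
      Summable fun k => ω k ^ 2 := by
  set P := Measure.infinitePi fun k => ProbabilityTheory.gaussianReal 0 (d k).toNNReal with hP
  have h1 : ∀ k, ∫⁻ ω : ℕ → ℝ, ENNReal.ofReal (ω k ^ 2) ∂P = ENNReal.ofReal (d k) := by
    intro k
    have hmp := measurePreserving_eval_infinitePi
      (fun k => ProbabilityTheory.gaussianReal 0 (d k).toNNReal) k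
    have := hmp.lintegral_comp (f := fun x : ℝ => ENNReal.ofReal (x ^ 2)) (by fun_prop)
    rw [this, ← ofReal_integral_eq_lintegral_ofReal]
    · congr 1
      have hv := ProbabilityTheory.variance_id_gaussianReal (μ := 0) (v := (d k).toNNReal)
      rw [ProbabilityTheory.variance_of_integral_eq_zero (by fun_prop) (by simp)] at hv
      simpa [hd k] using hv
    · exact (ProbabilityTheory.memLp_id_gaussianReal (μ := 0) (v := (d k).toNNReal) 2).integrable_sq
    · exact Filter.Eventually.of_forall fun x => sq_nonneg _
  have hm : ∀ k, Measurable fun ω : ℕ → ℝ => ENNReal.ofReal (ω k ^ 2) := fun k => by fun_prop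
  have h2 : ∫⁻ ω : ℕ → ℝ, ∑' k, ENNReal.ofReal (ω k ^ 2) ∂P ≠ ⊤ := by
    rw [lintegral_tsum fun k => (hm k).aemeasurable]
    simp_rw [h1]
    exact hs.tsum_ofReal_ne_top
  filter_upwards [ae_lt_top' (AEMeasurable.tsum fun k => (hm k).aemeasurable) h2] with ω hω
  have := ENNReal.summable_toReal hω.ne
  simpa [ENNReal.toReal_ofReal, sq_nonneg] using this

theorem exists_isCenteredGaussian [MeasurableSpace E] [BorelSpace E] (b : HilbertBasis ℕ ℝ E)
    {D : E →L[ℝ] E} {d : ℕ → ℝ} (hd : ∀ k, 0 ≤ d k) (hs : Summable d)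
    (hb : ∀ k, D (b k) = d k • b k) : ∃ ν : Measure E, IsCenteredGaussian ν D := by
  classical
  set P := Measure.infinitePi fun k => ProbabilityTheory.gaussianReal 0 (d k).toNNReal with hP
  let X : (ℕ → ℝ) → E := fun ω =>
    if h : Memℓp ω 2 then b.repr.symm ⟨ω, h⟩ else 0
  have hX : ∀ᵐ ω ∂P, HasSum (fun k => ω k • b k) (X ω) := by
    filter_upwards [ae_summable_sq hd hs] with ω hω
    have hm : Memℓp ω 2 := by
      rw [memℓp_gen_iff (by norm_num)]
      simpa using hω
    simp only [X, dif_pos hm]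
    exact b.hasSum_repr_symm ⟨ω, hm⟩
  have hY : ∀ N, Continuous fun ω : ℕ → ℝ => ∑ k ∈ Finset.range N, ω k • b k := fun N => by fun_prop
  have hXm : AEMeasurable X P :=
    aemeasurable_of_tendsto_metrizable_ae atTop (fun N => (hY N).measurable.aemeasurable)
      (hX.mono fun ω h => h.tendsto_sum_nat)
  refine ⟨P.map X, Measure.isProbabilityMeasure_map hXm, fun ξ => ?_⟩
  rw [charFun_apply, integral_map hXm (by fun_prop)]
  have hL : Tendsto (fun N => ∫ ω : ℕ → ℝ,
      Complex.exp ((∑ k ∈ Finset.range N, ω k * inner ℝ (b k) ξ : ℝ) * Complex.I) ∂P) atTop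
      (𝓝 (∫ ω, Complex.exp ((inner ℝ (X ω) ξ : ℝ) * Complex.I) ∂P)) := by
    refine tendsto_integral_of_dominated_convergence (fun _ => 1) (fun N => ?_)
      (integrable_const _) (fun N => ?_) ?_
    · exact Measurable.aestronglyMeasurable (by fun_prop)
    · exact Filter.Eventually.of_forall fun ω => (Complex.norm_exp_ofReal_mul_I _).le
    · filter_upwards [hX] with ω hω
      have h1 := (hω.mapL (innerSL ℝ ξ)).tendsto_sum_nat
      have h2 : Tendsto (fun N => ∑ k ∈ Finset.range N, ω k * inner ℝ (b k) ξ) atTop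
          (𝓝 (inner ℝ (X ω) ξ)) := by
        simpa [inner_smul_right, real_inner_comm] using h1
      exact ((Complex.continuous_exp.comp
        (Complex.continuous_ofReal.mul continuous_const)).tendsto _).comp h2
  refine tendsto_nhds_unique hL ?_
  simp_rw [hP, integral_exp_coords]
  have hq : HasSum (fun k => d k * inner ℝ (b k) ξ ^ 2) (inner ℝ (D ξ) ξ) := by
    have h1 := ((b.hasSum_repr ξ).mapL D).mapL (innerSL ℝ ξ)
    have h2 : (innerSL ℝ ξ) (D ξ) = inner ℝ (D ξ) ξ := by
      rw [innerSL_apply_apply, real_inner_comm]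
    rw [h2] at h1
    have h2' : (fun k => (innerSL ℝ) ξ (D (b.repr ξ k • b k))) =
        fun k => d k * inner ℝ (b k) ξ ^ 2 := by
      funext k
      rw [map_smul, hb, innerSL_apply_apply, inner_smul_right, inner_smul_right,
        b.repr_apply_apply, real_inner_comm]
      ring
    rwa [h2'] at h1
  have h3 := hq.tendsto_sum_nat
  have h4 : ∀ N, ∑ k ∈ Finset.range N, ((d k).toNNReal : ℝ) * inner ℝ (b k) ξ ^ 2 =
      ∑ k ∈ Finset.range N, d k * inner ℝ (b k) ξ ^ 2 := fun N =>
    Finset.sum_congr rfl fun k _ => by rw [Real.coe_toNNReal _ (hd k)]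
  simp_rw [h4]
  exact ((Complex.continuous_exp.comp
    ((Complex.continuous_ofReal.neg).div_const 2)).tendsto _).comp h3

theorem gaussianMeasure_spec [MeasurableSpace E] [BorelSpace E] (b : HilbertBasis ℕ ℝ E)
    {D : E →L[ℝ] E} {d : ℕ → ℝ} (hd : ∀ k, 0 ≤ d k) (hs : Summable d)
    (hb : ∀ k, D (b k) = d k • b k) : IsCenteredGaussian (gaussianMeasure D) D := by
  have h := exists_isCenteredGaussian b hd hs hb
  rw [gaussianMeasure, dif_pos h]
  exact h.choose_spec

/-- `u` is the Pettis integral of `F`: `(g, u) = ∫ (g, F ω) dν(ω)` for all `g`, where these scalar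
integrals exist. -/
def HasPettisIntegral {Ω H : Type*} [MeasurableSpace Ω] [NormedAddCommGroup H]
    [InnerProductSpace ℂ H] (ν : Measure Ω) (F : Ω → H) (u : H) : Prop :=
  ∀ g : H, Integrable (fun ω => inner ℂ g (F ω)) ν ∧ inner ℂ g u = ∫ ω, inner ℂ g (F ω) ∂ν

/-- Pettis integrability. -/
def PettisIntegrable {Ω H : Type*} [MeasurableSpace Ω] [NormedAddCommGroup H]
    [InnerProductSpace ℂ H] (ν : Measure Ω) (F : Ω → H) : Prop :=
  ∃ u, HasPettisIntegral ν F u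

open Classical in
/-- The Pettis integral (`0` if it does not exist). -/
def pettisIntegral {Ω H : Type*} [MeasurableSpace Ω] [NormedAddCommGroup H]
    [InnerProductSpace ℂ H] (ν : Measure Ω) (F : Ω → H) : H :=
  if h : ∃ u, HasPettisIntegral ν F u then h.choose else 0

/-- The Gaussian average of shifts, `U_D f = ∫ S_h f dν_D(h)` in the sense of Pettis. -/
def avgShift [MeasurableSpace E] (b : HilbertBasis ℕ ℝ E) (D : E →L[ℝ] E) (f : HE b) : HE b :=
  pettisIntegral (gaussianMeasure D) fun h => shift b h f

theorem HasPettisIntegral.unique {Ω H : Type*} [MeasurableSpace Ω] [NormedAddCommGroup H]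
    [InnerProductSpace ℂ H] {ν : Measure Ω} {F : Ω → H} {u v : H}
    (hu : HasPettisIntegral ν F u) (hv : HasPettisIntegral ν F v) : u = v :=
  ext_inner_left ℂ fun g => (hu g).2.trans (hv g).2.symm

theorem HasPettisIntegral.pettisIntegral_eq {Ω H : Type*} [MeasurableSpace Ω]
    [NormedAddCommGroup H] [InnerProductSpace ℂ H] {ν : Measure Ω} {F : Ω → H} {u : H}
    (hu : HasPettisIntegral ν F u) : pettisIntegral ν F = u := by
  have h : ∃ u, HasPettisIntegral ν F u := ⟨u, hu⟩
  rw [pettisIntegral, dif_pos h]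
  exact h.choose_spec.unique hu

end Averaging

end CoordShift
end

noncomputable section
namespace CoordShift

open Filter Topology MeasureTheory ProbabilityTheory
open scoped ComplexConjugate

/-! ### Coordinates of a diagonal Gaussian measure and the one-dimensional estimate -/

section GaussianCoordinates

variable {E : Type*} [NormedAddCommGroup E] [InnerProductSpace ℝ E]

/-! Let `W` be a block with edges `l_j ≤ C`, let `A` be diagonal with eigenvalues `a_j`, and let `u
= U_A χ_W`. Testing the Pettis integral against `u` itself gives `‖u‖² = ∫ (u, S_h χ_W) dν(h)`, so
it is enough to bound `(S_h χ_W, u)` uniformly in `h`. A second use of the Pettis identity turns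
this into `∫ λ((W + h) ∩ (W + h')) dν(h')`.

The two translates overlap along `e_j` in an edge of length `max(0, l_j - |h_j - h'_j|) ≤ l_j
exp(-|h_j - h'_j| / C)`. Hence the integrand is at most `vol W` times a product of Laplace kernels
in any finite set of coordinates (`lam_shift_inter_shift_le`). Under `ν` the coordinates are
independent centred Gaussians of variance `a_j` (`IsCenteredGaussian.map_coords`), and the integral
of the product factorises.

The decisive point is that each factor is at most `exp(-κ √a_j)`, whatever the centre `h_j`
(`exists_integral_exp_abs_le`). The loss is linear in the standard deviation, not in the variance,
because the kernel has a corner at its maximum. Thus `‖u‖² ≤ vol W · exp(-κ ∑_{j<n} √a_j)`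
(`exists_norm_sq_le`). The constant `κ` depends only on `W` and on a bound for the `√a_j`, so the
estimate serves a whole sequence of operators.

If `D^{1/2}` is not nuclear, the sum of its eigenvalues `√d_j` diverges and the bound tends to zero,
both for the fixed operator `tD` with growing `n` and for the truncations `tD_n`. Block indicators
span a dense subspace and all averages are contractions, so the conclusion passes to every `f`
(`tendsto_avgShift_zero`). -/

theorem inner_diagonal {b : HilbertBasis ℕ ℝ E} {A : E →L[ℝ] E} {a : ℕ → ℝ}
    (hb : ∀ k, A (b k) = a k • b k) {n : ℕ} (t : Fin n → ℝ) :
    inner ℝ (A (∑ j, t j • b j)) (∑ j, t j • b j) = ∑ j : Fin n, a j * t j ^ 2 := by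
  have hAt : A (∑ j, t j • b j) = ∑ j : Fin n, (t j * a j) • b j := by
    simp [map_sum, hb, smul_smul]
  have ho : Orthonormal ℝ fun j : Fin n => b j := b.orthonormal.comp _ Fin.val_injective
  rw [hAt, ho.inner_sum]
  refine Finset.sum_congr rfl fun j _ => ?_
  simp only [conj_trivial]
  ring

/-- On the span of finitely many basis vectors the quadratic form of `A` is a sum of squares, so the
Fourier transform splits into a product of one-dimensional Gaussian ones. This is the independence
of the coordinates. -/
theorem IsCenteredGaussian.map_coords [MeasurableSpace E] [BorelSpace E] {b : HilbertBasis ℕ ℝ E}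
    {A : E →L[ℝ] E} {a : ℕ → ℝ} (ha : ∀ k, 0 ≤ a k) (hb : ∀ k, A (b k) = a k • b k)
    {ν : Measure E} (hν : IsCenteredGaussian ν A) (n : ℕ) :
    ν.map (fun h (j : Fin n) => inner ℝ (b j) h) =
      Measure.pi fun j : Fin n => gaussianReal 0 (a j).toNNReal := by
  have hm : Measurable fun (h : E) (j : Fin n) => inner ℝ (b j) h :=
    Continuous.measurable (by fun_prop)
  have := hν.1
  have := Measure.isProbabilityMeasure_map (μ := ν) hm.aemeasurable
  rw [← charFun_eq_pi_iff]
  intro t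
  rw [Measure.map_map (by fun_prop) hm, charFun_apply, integral_map (by fun_prop) (by fun_prop)]
  -- The characteristic function of the image measure at `t` is that of `ν` at `∑ t_j b_j`.
  have h := hν.2 (∑ j, t j • b j)
  rw [charFun_apply, inner_diagonal hb] at h
  have h1 : ∀ x : E, inner ℝ ((WithLp.toLp 2 ∘ fun (h : E) (j : Fin n) => inner ℝ (b j) h) x) t =
      inner ℝ x (∑ j, t j • b j) := by
    intro x
    simp only [Function.comp_apply, PiLp.inner_apply, inner_sum, inner_smul_right]
    refine Finset.sum_congr rfl fun j _ => ?_
    simp [real_inner_comm]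
  simp_rw [h1]
  rw [h]
  simp_rw [charFun_gaussianReal]
  rw [← Complex.exp_sum]
  congr 1
  push_cast
  rw [← Finset.sum_neg_distrib, Finset.sum_div]
  refine Finset.sum_congr rfl fun j _ => ?_
  rw [Real.coe_toNNReal _ (ha j)]
  ring

theorem IsCenteredGaussian.integral_prod_coords [MeasurableSpace E] [BorelSpace E]
    {b : HilbertBasis ℕ ℝ E} {A : E →L[ℝ] E} {a : ℕ → ℝ} (ha : ∀ k, 0 ≤ a k)
    (hb : ∀ k, A (b k) = a k • b k) {ν : Measure E} (hν : IsCenteredGaussian ν A) (n : ℕ)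
    {φ : ℕ → ℝ → ℝ} (hφ : ∀ k, Continuous (φ k)) :
    ∫ h, ∏ j ∈ Finset.range n, φ j (inner ℝ (b j) h) ∂ν =
      ∏ j ∈ Finset.range n, ∫ x, φ j x ∂(gaussianReal 0 (a j).toNNReal) := by
  have hm : Measurable fun (h : E) (j : Fin n) => inner ℝ (b j) h :=
    Continuous.measurable (by fun_prop)
  simp_rw [Finset.prod_range]
  rw [← integral_fintype_prod_eq_prod (f := fun (j : Fin n) => φ j), ← hν.map_coords ha hb n,
    integral_map hm.aemeasurable]
  exact Continuous.aestronglyMeasurable (by fun_prop)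

/-- Expand `(1 - e^{-p})(1 - e^{-q}) ≥ 0` and use `e^{-p} e^{-q} ≤ e^{-r}`. -/
theorem exp_neg_add_exp_neg_le {p q r : ℝ} (hp : 0 ≤ p) (hq : 0 ≤ q) (h : r ≤ p + q) :
    Real.exp (-p) + Real.exp (-q) ≤ 1 + Real.exp (-r) := by
  have h1 : Real.exp (-p) ≤ 1 := Real.exp_le_one_iff.2 (by linarith)
  have h2 : Real.exp (-q) ≤ 1 := Real.exp_le_one_iff.2 (by linarith)
  have h3 : Real.exp (-p) * Real.exp (-q) ≤ Real.exp (-r) := by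
    rw [← Real.exp_add]
    exact Real.exp_le_exp.2 (by linarith)
  nlinarith [mul_nonneg (sub_nonneg.2 h1) (sub_nonneg.2 h2)]

/-- By convexity, the function `σ ↦ e^{-σ y}` lies below its chord over `[0, S]`. This is the source
of the linear dependence on `σ`. -/
theorem exp_neg_mul_le {σ S y : ℝ} (hσ : 0 ≤ σ) (hS : 0 < S) (hσS : σ ≤ S) :
    Real.exp (-(σ * y)) ≤ 1 - σ / S * (1 - Real.exp (-(S * y))) := by
  have h := convexOn_exp.2 (Set.mem_univ (-(S * y))) (Set.mem_univ 0)
    (div_nonneg hσ hS.le) (sub_nonneg.2 ((div_le_one hS).2 hσS)) (by ring)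
  have h1 : σ / S * -(S * y) = -(σ * y) := by field_simp
  simp only [smul_eq_mul, mul_zero, add_zero, Real.exp_zero, mul_one, h1] at h
  linarith

theorem integrable_of_continuous_of_abs_le {X : Type*} [TopologicalSpace X] [MeasurableSpace X]
    [OpensMeasurableSpace X] {μ : Measure X} [IsFiniteMeasure μ] {f : X → ℝ} (hf : Continuous f)
    {C : ℝ} (hC : ∀ x, |f x| ≤ C) : Integrable f μ :=
  Integrable.of_bound hf.measurable.aestronglyMeasurable C (Eventually.of_forall hC)

/-- A Gaussian average of a Laplace kernel is small, uniformly in the centre of the kernel. -/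
theorem exists_integral_exp_abs_le {C S : ℝ} (hC : 0 < C) (hS : 0 < S) :
    ∃ κ > 0, ∀ σ, 0 ≤ σ → σ ≤ S → ∀ δ : ℝ,
      ∫ x, Real.exp (-(|δ - x| / C)) ∂(gaussianReal 0 (σ ^ 2).toNNReal) ≤ Real.exp (-(κ * σ)) := by
  set γ := gaussianReal 0 1 with hγ
  have hint : ∀ g : ℝ → ℝ, Continuous g → (∀ x, 0 ≤ g x) →
      Integrable (fun x => Real.exp (-g x)) γ := fun g hg h0 =>
    integrable_of_continuous_of_abs_le (by fun_prop) (C := 1) fun x => by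
      rw [abs_of_pos (Real.exp_pos _)]
      exact Real.exp_le_one_iff.2 (by linarith [h0 x])
  -- The mean loss at the largest scale `S`. The integrand vanishes only at `0`, which is not an
  -- atom of the standard Gaussian, so `c > 0`.
  set c := ∫ x, (1 - Real.exp (-(S * (2 * |x| / C)))) ∂γ with hc
  have hIc : Integrable (fun x : ℝ => 1 - Real.exp (-(S * (2 * |x| / C)))) γ :=
    (integrable_const 1).sub (hint _ (by fun_prop) fun x => by positivity)
  have hcpos : 0 < c := by
    rw [hc, integral_pos_iff_support_of_nonneg _ hIc]
    · have hsub : ({0}ᶜ : Set ℝ) ⊆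
          Function.support fun x : ℝ => 1 - Real.exp (-(S * (2 * |x| / C))) := by
        intro x hx
        have hx' : 0 < |x| := abs_pos.2 hx
        have : Real.exp (-(S * (2 * |x| / C))) < 1 := Real.exp_lt_one_iff.2 (by
          have : 0 < S * (2 * |x| / C) := by positivity
          linarith)
        exact (sub_pos.2 this).ne'
      refine lt_of_lt_of_le ?_ (measure_mono hsub)
      have := nullSingletonClass_gaussianReal (μ := 0) (v := 1) one_ne_zero
      rw [prob_compl_eq_one_sub (measurableSet_singleton 0), measure_singleton]
      simp
    · intro x
      have : Real.exp (-(S * (2 * |x| / C))) ≤ 1 := Real.exp_le_one_iff.2 (by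
        have : 0 ≤ S * (2 * |x| / C) := by positivity
        linarith)
      exact sub_nonneg.2 this
  -- The slope `1 / S` comes from the chord, the factor `1 / 2` from averaging over the reflection
  -- `x ↦ -x`.
  refine ⟨c / (2 * S), by positivity, fun σ hσ hσS δ => ?_⟩
  -- Rescaling to the standard Gaussian; the degenerate case `σ = 0` is included.
  have hmap : gaussianReal 0 (σ ^ 2).toNNReal = γ.map (σ * ·) := by
    rw [hγ, gaussianReal_map_const_mul, mul_zero, mul_one]
    congr 1
    ext
    exact Real.coe_toNNReal _ (sq_nonneg _)
  have hneg : γ = γ.map (fun x => -x) := by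
    rw [hγ, gaussianReal_map_neg, neg_zero]
  have e1 : ∫ x, Real.exp (-(|δ - x| / C)) ∂(gaussianReal 0 (σ ^ 2).toNNReal) =
      ∫ x, Real.exp (-(|δ - σ * x| / C)) ∂γ := by
    rw [hmap, integral_map (by fun_prop) (by fun_prop)]
  have e2 : ∫ x, Real.exp (-(|δ - σ * x| / C)) ∂γ = ∫ x, Real.exp (-(|δ + σ * x| / C)) ∂γ := by
    conv_lhs => rw [hneg]
    rw [integral_map (by fun_prop) (by fun_prop)]
    simp
  have hI1 := hint (fun x => |δ - σ * x| / C) (by fun_prop) fun x => by positivity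
  have hI2 := hint (fun x => |δ + σ * x| / C) (by fun_prop) fun x => by positivity
  have key : ∫ x, (Real.exp (-(|δ - σ * x| / C)) + Real.exp (-(|δ + σ * x| / C))) ∂γ ≤
      ∫ x, (2 - σ / S * (1 - Real.exp (-(S * (2 * |x| / C))))) ∂γ := by
    refine integral_mono (hI1.add hI2) ((integrable_const 2).sub (hIc.const_mul _)) fun x => ?_
    -- The triangle inequality for `(δ + σx) - (δ - σx)` eliminates `δ`; hence the uniformity in the
    -- centre.
    have h1 : σ * (2 * |x| / C) ≤ |δ - σ * x| / C + |δ + σ * x| / C := by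
      rw [← add_div, mul_div_assoc']
      refine div_le_div_of_nonneg_right ?_ hC.le
      have := abs_sub (δ + σ * x) (δ - σ * x)
      have h2 : |(δ + σ * x) - (δ - σ * x)| = σ * (2 * |x|) := by
        rw [show (δ + σ * x) - (δ - σ * x) = σ * (2 * x) by ring, abs_mul, abs_mul,
          abs_of_nonneg hσ, abs_two]
      linarith
    have h3 := exp_neg_add_exp_neg_le (by positivity) (by positivity) h1
    have h4 := exp_neg_mul_le (y := 2 * |x| / C) hσ hS hσS
    simp only
    linarith
  rw [integral_add hI1 hI2, ← e2, integral_sub (integrable_const 2) (hIc.const_mul _),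
    integral_const_mul, ← hc] at key
  rw [e1]
  -- `key` bounds the integral by `1 - κσ`, and `1 - κσ ≤ e^{-κσ}`.
  have h5 := Real.add_one_le_exp (-(c / (2 * S) * σ))
  have h6 : c / (2 * S) * σ = σ / S * c / 2 := by field_simp
  simp at key
  linarith

end GaussianCoordinates

/-! ### Overlaps of blocks and density of their indicators -/

section BlockIndicators

variable {E : Type*} [NormedAddCommGroup E] [InnerProductSpace ℝ E] {b : HilbertBasis ℕ ℝ E}

/-- The intersection of two blocks with a common point. -/
def AbsBlock.inter (Q W : AbsBlock b) (h : (Q.carrier ∩ W.carrier).Nonempty) : AbsBlock b where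
  lo j := max (Q.lo j) (W.lo j)
  hi j := min (Q.hi j) (W.hi j)
  lo_bdd := by
    obtain ⟨C, hC⟩ := Q.lo_bdd
    obtain ⟨D, hD⟩ := W.lo_bdd
    exact ⟨max C D, fun j => abs_max_le_max_abs_abs.trans (max_le_max (hC j) (hD j))⟩
  hi_bdd := by
    obtain ⟨C, hC⟩ := Q.hi_bdd
    obtain ⟨D, hD⟩ := W.hi_bdd
    exact ⟨max C D, fun j => abs_min_le_max_abs_abs.trans (max_le_max (hC j) (hD j))⟩
  lt j := by
    obtain ⟨x, hx⟩ := h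
    exact (max_le (hx.1 j).1 (hx.2 j).1).trans_lt (lt_min (hx.1 j).2 (hx.2 j).2)
  meas := by
    obtain ⟨x, hx⟩ := h
    have hQ := Q.meas.resolve_left (Set.nonempty_iff_ne_empty.1 ⟨x, hx.1⟩)
    refine Or.inr (Summable.of_nonneg_of_le (fun j => le_max_left _ _) (fun j => ?_) hQ)
    have h1 : 0 < min (Q.hi j) (W.hi j) - max (Q.lo j) (W.lo j) :=
      sub_pos.2 ((max_le (hx.1 j).1 (hx.2 j).1).trans_lt (lt_min (hx.1 j).2 (hx.2 j).2))
    exact max_le_max le_rfl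
      (Real.log_le_log h1 (sub_le_sub (min_le_left _ _) (le_max_left _ _)))

theorem AbsBlock.inter_carrier (Q W : AbsBlock b) (h : (Q.carrier ∩ W.carrier).Nonempty) :
    (Q.inter W h).carrier = Q.carrier ∩ W.carrier := by
  ext y
  simp only [AbsBlock.carrier, box, Set.mem_inter_iff, Set.mem_ofPred_eq, Set.mem_Ico,
    AbsBlock.inter, max_le_iff, lt_min_iff, ← forall_and]
  exact forall_congr' fun j => by tauto

/-- Overlap in each coordinate separately does not by itself give a point of `E`, whose coordinates
must be square summable. `exists_point`, with no coordinates prescribed, selects such a point using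
one from each block. -/
theorem AbsBlock.inter_nonempty {Q W : AbsBlock b} (hQ : Q.carrier.Nonempty)
    (hW : W.carrier.Nonempty) (h : ∀ j, max (Q.lo j) (W.lo j) < min (Q.hi j) (W.hi j)) :
    (Q.carrier ∩ W.carrier).Nonempty := by
  classical
  obtain ⟨x, hx, -⟩ := exists_point {Q, W} ⟨Q, by simp⟩ (by simp [hQ, hW]) 0 0 (by simp) (by
    have hj := fun j => max_lt_iff.1 (h j)
    simp only [lt_min_iff] at hj
    simpa [-not_lt, forall_and] using
      ⟨⟨fun j => (hj j).1.1, fun j => (hj j).2.1⟩, fun j => (hj j).1.2, fun j => (hj j).2.2⟩)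
  exact ⟨x, hx Q (by simp), hx W (by simp)⟩

theorem lam_empty (b : HilbertBasis ℕ ℝ E) : lam b ∅ = 0 := by
  refine le_antisymm ?_ (Real.sInf_nonneg ?_)
  · have h0 : ringVol b ∅ = 0 := by
      have := ringVol_sdiff (isSetRing_blockRing b).empty_mem (isSetRing_blockRing b).empty_mem
        subset_rfl
      simpa using this
    exact (lam_le (isSetRing_blockRing b).empty_mem subset_rfl).trans_eq h0
  · rintro _ ⟨A, hA, rfl⟩
    exact ringVol_nonneg hA.1

/-- The volume of the intersection of two nonempty blocks is the limit of the finite products of the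
lengths of the overlaps of their edges. -/
theorem tendsto_lam_inter {Q W : AbsBlock b} (hQ : Q.carrier.Nonempty) (hW : W.carrier.Nonempty) :
    Tendsto (fun N => ∏ j ∈ Finset.range N,
      max 0 (min (Q.hi j) (W.hi j) - max (Q.lo j) (W.lo j))) atTop
      (𝓝 (lam b (Q.carrier ∩ W.carrier))) := by
  by_cases h : (Q.carrier ∩ W.carrier).Nonempty
  · rw [← Q.inter_carrier W h, lam_carrier]
    refine (AbsBlock.tendsto_vol (by rwa [Q.inter_carrier W h])).congr fun N =>
      Finset.prod_congr rfl fun j _ => (max_eq_right (sub_pos.2 ((Q.inter W h).lt j)).le).symm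
  · have hj : ∃ j, min (Q.hi j) (W.hi j) ≤ max (Q.lo j) (W.lo j) := by
      by_contra! hcon
      exact h (AbsBlock.inter_nonempty hQ hW hcon)
    obtain ⟨j, hj⟩ := hj
    rw [Set.not_nonempty_iff_eq_empty.1 h, lam_empty]
    refine tendsto_const_nhds.congr' ?_
    filter_upwards [eventually_gt_atTop j] with N hN
    refine (Finset.prod_eq_zero (Finset.mem_range.2 hN) ?_).symm
    exact max_eq_left (sub_nonpos.2 hj)

/-- The class of the indicator of a block. -/
def blockInd (Q : AbsBlock b) : HE b :=
  (SimpleFn.ind ⟨Q.carrier, blockRing_subset_completedRing (carrier_mem_blockRing Q)⟩ :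
    SimpleFn b)

theorem inner_blockInd (Q W : AbsBlock b) :
    inner ℂ (blockInd Q) (blockInd W) = (lam b (Q.carrier ∩ W.carrier) : ℂ) := by
  rw [blockInd, blockInd, UniformSpace.Completion.inner_coe, SimpleFn.inner_ind]

theorem shift_blockInd (h : E) (Q : AbsBlock b) : shift b h (blockInd Q) = blockInd (Q.shift h) := by
  rw [blockInd, shift_coe, blockInd]
  congr 1
  refine Subtype.ext (funext fun x => ?_)
  simp only [SimpleFn.ind, AbsBlock.shift_carrier]
  rfl

theorem AbsBlock.shift_carrier_nonempty (h : E) {W : AbsBlock b} (hW : W.carrier.Nonempty) :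
    (W.shift h).carrier.Nonempty := by
  obtain ⟨x, hx⟩ := hW
  exact ⟨x + h, by rw [AbsBlock.shift_carrier]; simpa using hx⟩

theorem norm_shift (h : E) (f : HE b) : ‖shift b h f‖ = ‖f‖ := by
  induction f using UniformSpace.Completion.induction_on with
  | hp => exact isClosed_eq (by fun_prop) (by fun_prop)
  | ih f =>
    rw [shift_coe, UniformSpace.Completion.norm_coe, UniformSpace.Completion.norm_coe]
    exact (simpleShift b h).norm_map f

/-- The indicator of a set of the minimal ring is, as a function, a finite combination of block
indicators; no limit is needed at this stage. -/
theorem ind_mem_span {A : Set E} (hA : A ∈ blockRing b) :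
    ((SimpleFn.ind ⟨A, blockRing_subset_completedRing hA⟩ : SimpleFn b) : HE b) ∈
      Submodule.span ℂ (Set.range (blockInd (b := b))) := by
  obtain ⟨c, hc⟩ := blockRing_indicator_mem hA
  have hkey : (SimpleFn.ind ⟨A, blockRing_subset_completedRing hA⟩ : SimpleFn b) =
      ∑ Q ∈ c.support, c Q •
        (SimpleFn.ind ⟨Q.carrier, blockRing_subset_completedRing (carrier_mem_blockRing Q)⟩ :
          SimpleFn b) := by
    refine Subtype.ext ?_
    refine hc.symm.trans ?_
    simp only [stepFun, Finsupp.linearCombination_apply, Finsupp.sum]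
    exact (map_sum (simpleFns b).subtype (fun Q => c Q • (⟨Q.carrier.indicator 1,
      Submodule.subset_span ⟨_, blockRing_subset_completedRing (carrier_mem_blockRing Q), rfl⟩⟩ :
        simpleFns b)) c.support).symm
  rw [hkey, ← UniformSpace.Completion.coe_toComplL (𝕜 := ℂ), map_sum]
  exact Submodule.sum_mem _ fun Q _ => by
    rw [map_smul]
    exact Submodule.smul_mem _ _ (Submodule.subset_span ⟨Q, rfl⟩)

/-- For nested sets both cross terms of the square equal the measure of the smaller set. -/
theorem norm_ind_sub_ind_sq {A B : completedRing b} (h : (A : Set E) ⊆ B) :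
    ‖SimpleFn.ind B - SimpleFn.ind A‖ ^ 2 = lam b (B : Set E) - lam b (A : Set E) := by
  rw [← @inner_self_eq_norm_sq ℂ, inner_sub_left, inner_sub_right, inner_sub_right]
  simp only [SimpleFn.inner_ind, Set.inter_self, Set.inter_eq_self_of_subset_left h,
    Set.inter_eq_self_of_subset_right h]
  simp

/-- The indicators of blocks span a dense subspace. -/
theorem topologicalClosure_span_blockInd :
    (Submodule.span ℂ (Set.range (blockInd (b := b)))).topologicalClosure = ⊤ := by
  set S := (Submodule.span ℂ (Set.range (blockInd (b := b)))).topologicalClosure with hS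
  have hind : ∀ B : completedRing b, ((SimpleFn.ind B : SimpleFn b) : HE b) ∈ S := by
    intro B
    rw [hS, ← SetLike.mem_coe, Submodule.topologicalClosure_coe, Metric.mem_closure_iff]
    intro ε hε
    -- The tolerance is `ε ^ 2` because the norm is the square root of the measure; the inner set
    -- `A₁` is the approximant.
    obtain ⟨A₁, hA₁, A₂, hA₂, h1, h2, h3⟩ := B.2 (ε ^ 2) (by positivity)
    refine ⟨_, ind_mem_span hA₁, ?_⟩
    rw [UniformSpace.Completion.dist_eq, dist_eq_norm]
    refine lt_of_pow_lt_pow_left₀ 2 hε.le ?_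
    rw [norm_ind_sub_ind_sq h1, lam_eq_ringVol hA₁]
    rw [ringVol_sdiff hA₁ hA₂ (h1.trans h2)] at h3
    linarith [lam_le hA₂ h2]
  have hsimple : ∀ f : SimpleFn b, (f : HE b) ∈ S := by
    rintro ⟨f, hf⟩
    refine Submodule.span_induction
      (p := fun f hf => UniformSpace.Completion.coe' (show SimpleFn b from ⟨f, hf⟩) ∈ S)
      ?_ ?_ ?_ ?_ hf
    · rintro _ ⟨B, hB, rfl⟩
      exact hind ⟨B, hB⟩
    · exact zero_mem S
    · intro f g hf hg h1 h2
      have := add_mem h1 h2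
      rwa [← UniformSpace.Completion.coe_add] at this
    · intro z f hf h1
      have := S.smul_mem z h1
      rwa [← UniformSpace.Completion.coe_smul] at this
  refine Submodule.eq_top_iff'.2 fun f => ?_
  induction f using UniformSpace.Completion.induction_on with
  | hp => exact Submodule.isClosed_topologicalClosure _
  | ih f => exact hsimple f

/-- The reduction principle used twice below: a property of `f` that is linear and closed under
limits need only be checked on block indicators. -/
theorem closed_submodule_eq_top {S : Submodule ℂ (HE b)} (hS : IsClosed (S : Set (HE b)))
    (h : ∀ Q : AbsBlock b, blockInd Q ∈ S) : S = ⊤ := by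
  refine eq_top_iff.2 (topologicalClosure_span_blockInd.symm.trans_le ?_)
  refine Submodule.topologicalClosure_minimal _ (Submodule.span_le.2 ?_) hS
  rintro _ ⟨Q, rfl⟩
  exact h Q

end BlockIndicators

/-! ### Weak measurability of shifts and existence of the Pettis integral -/

section PettisIntegral

variable {E : Type*} [NormedAddCommGroup E] [InnerProductSpace ℝ E] [MeasurableSpace E]
  [BorelSpace E] {b : HilbertBasis ℕ ℝ E}

/-- A pointwise limit of finite products, each of which is continuous in `h`. -/
theorem measurable_lam_inter_shift (Q W : AbsBlock b) :
    Measurable fun h => lam b (Q.carrier ∩ (W.shift h).carrier) := by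
  rcases Q.carrier.eq_empty_or_nonempty with hQ | hQ
  · simp [hQ]
  rcases W.carrier.eq_empty_or_nonempty with hW | hW
  · simp [AbsBlock.shift_carrier, hW]
  refine measurable_of_tendsto_metrizable (fun N => ?_)
    (tendsto_pi_nhds.2 fun h => tendsto_lam_inter hQ (W.shift_carrier_nonempty h hW))
  simp only [AbsBlock.shift]
  exact Continuous.measurable (by fun_prop)

/-- For two block indicators the matrix element is the measure of an overlap. Density extends this
first to every `f`, then to every `g`. -/
theorem measurable_inner_shift (g f : HE b) : Measurable fun h : E => inner ℂ g (shift b h f) := by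
  -- The common closure argument: a pointwise limit of a sequence of measurable functions is
  -- measurable, so the submodule of admissible vectors is closed.
  have hlim : ∀ {S : Submodule ℂ (HE b)} {F : HE b → E → ℂ}, (∀ h, Continuous fun f => F f h) →
      (∀ f, f ∈ S ↔ Measurable (F f)) → (∀ Q : AbsBlock b, Measurable (F (blockInd Q))) →
      ∀ f, Measurable (F f) := by
    intro S F hF hS hQ f
    have htop : S = ⊤ := closed_submodule_eq_top (isClosed_of_closure_subset fun f hf => by
      obtain ⟨u, hu, hlim⟩ := mem_closure_iff_seq_limit.1 hf
      refine (hS f).2 (measurable_of_tendsto_metrizable (fun n => (hS _).1 (hu n))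
        (tendsto_pi_nhds.2 fun h => ((hF h).tendsto f).comp hlim))) fun Q => (hS _).2 (hQ Q)
    exact (hS f).1 (htop ▸ Submodule.mem_top)
  let S₁ (Q : AbsBlock b) : Submodule ℂ (HE b) :=
    { carrier := {f | Measurable fun h : E => inner ℂ (blockInd Q) (shift b h f)}
      add_mem' := fun hf hg => by
        simp only [Set.mem_ofPred_eq, map_add, inner_add_right] at hf hg ⊢
        exact hf.add hg
      zero_mem' := by simp
      smul_mem' := fun z f hf => by
        simpa only [Set.mem_ofPred_eq, map_smul, inner_smul_right] using hf.const_mul z }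
  let S₂ (f : HE b) : Submodule ℂ (HE b) :=
    { carrier := {g | Measurable fun h : E => inner ℂ g (shift b h f)}
      add_mem' := fun hf hg => by
        simp only [Set.mem_ofPred_eq, inner_add_left] at hf hg ⊢
        exact hf.add hg
      zero_mem' := by simp
      smul_mem' := fun z f hf => by
        simpa only [Set.mem_ofPred_eq, inner_smul_left] using hf.const_mul _ }
  refine hlim (S := S₂ f) (F := fun g h => inner ℂ g (shift b h f)) (fun h => by fun_prop)
    (fun _ => Iff.rfl) (fun Q => ?_) g
  refine hlim (S := S₁ Q) (F := fun f h => inner ℂ (blockInd Q) (shift b h f))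
    (fun h => by fun_prop) (fun _ => Iff.rfl) (fun W => ?_) f
  simp only [shift_blockInd, inner_blockInd]
  exact Complex.measurable_ofReal.comp (measurable_lam_inter_shift Q W)

theorem integrable_inner_shift (ν : Measure E) [IsFiniteMeasure ν] (g f : HE b) :
    Integrable (fun h => inner ℂ g (shift b h f)) ν :=
  Integrable.of_bound (measurable_inner_shift g f).aestronglyMeasurable (‖g‖ * ‖f‖)
    (Eventually.of_forall fun h => (norm_inner_le_norm _ _).trans_eq (by rw [norm_shift]))

/-- Riesz representation: shifts are isometric and `ν` has mass one, so the averaged functional is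
bounded by `‖f‖`. -/
theorem pettisIntegrable_shift (ν : Measure E) [IsProbabilityMeasure ν] (f : HE b) :
    PettisIntegrable ν fun h => shift b h f := by
  -- The inner product is conjugate-linear on the left, so the functional is formed with `g` on the
  -- right and conjugated at the end.
  have hconj : ∀ (g : HE b) (h : E),
      inner ℂ (shift b h f) g = conj (inner ℂ g (shift b h f)) := fun g h =>
    (inner_conj_symm _ _).symm
  have hint : ∀ g : HE b, Integrable (fun h => inner ℂ (shift b h f) g) ν := fun g => by
    simp_rw [hconj]
    exact (Complex.conjLIE.toContinuousLinearEquiv : ℂ →L[ℝ] ℂ).integrable_comp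
      (integrable_inner_shift ν g f)
  let L : HE b →L[ℂ] ℂ := LinearMap.mkContinuous
    { toFun := fun g => ∫ h, inner ℂ (shift b h f) g ∂ν
      map_add' := fun g g' => by
        simp only [inner_add_right]
        exact integral_add (hint g) (hint g')
      map_smul' := fun z g => by
        simp only [inner_smul_right, RingHom.id_apply, smul_eq_mul]
        exact integral_const_mul _ _ } ‖f‖ fun g => by
      refine (norm_integral_le_of_norm_le_const (C := ‖f‖ * ‖g‖)
        (Eventually.of_forall fun h => ?_)).trans_eq (by simp)
      exact (norm_inner_le_norm _ _).trans_eq (by rw [norm_shift])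
  refine ⟨(InnerProductSpace.toDual ℂ (HE b)).symm L, fun g => ⟨integrable_inner_shift ν g f, ?_⟩⟩
  rw [← inner_conj_symm, InnerProductSpace.toDual_symm_apply]
  change conj (∫ h, inner ℂ (shift b h f) g ∂ν) = _
  rw [← integral_conj]
  simp only [inner_conj_symm]

/-- Take `g = u` in the defining identity. The remaining quantity `(F ω, u)` can again be written as
an integral, which is how the bound `K` is found. -/
theorem HasPettisIntegral.norm_sq_le {Ω H : Type*} [MeasurableSpace Ω] [NormedAddCommGroup H]
    [InnerProductSpace ℂ H] {ν : Measure Ω} [IsProbabilityMeasure ν] {F : Ω → H} {u : H}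
    (hu : HasPettisIntegral ν F u) {K : ℝ} (hK : ∀ ω, ‖inner ℂ (F ω) u‖ ≤ K) : ‖u‖ ^ 2 ≤ K := by
  have h1 : ‖inner ℂ u u‖ ≤ K := by
    rw [(hu u).2]
    refine (norm_integral_le_of_norm_le_const (C := K)
      (Eventually.of_forall fun ω => ?_)).trans_eq (by simp)
    rw [norm_inner_symm]
    exact hK ω
  rwa [inner_self_eq_norm_sq_to_K, norm_pow, RCLike.norm_ofReal, abs_norm] at h1

theorem HasPettisIntegral.add {Ω H : Type*} [MeasurableSpace Ω] [NormedAddCommGroup H]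
    [InnerProductSpace ℂ H] {ν : Measure Ω} {F G : Ω → H} {u v : H}
    (hu : HasPettisIntegral ν F u) (hv : HasPettisIntegral ν G v) :
    HasPettisIntegral ν (fun ω => F ω + G ω) (u + v) := fun g => by
  simp only [inner_add_right]
  exact ⟨(hu g).1.add (hv g).1, by rw [integral_add (hu g).1 (hv g).1, (hu g).2, (hv g).2]⟩

theorem HasPettisIntegral.smul {Ω H : Type*} [MeasurableSpace Ω] [NormedAddCommGroup H]
    [InnerProductSpace ℂ H] {ν : Measure Ω} {F : Ω → H} {u : H} (z : ℂ)
    (hu : HasPettisIntegral ν F u) : HasPettisIntegral ν (fun ω => z • F ω) (z • u) := fun g => by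
  simp only [inner_smul_right]
  exact ⟨(hu g).1.const_mul z, by rw [integral_const_mul, (hu g).2]⟩

end PettisIntegral

/-! ### Exponential decay of the averages of a block indicator -/

section BlockEstimate

variable {E : Type*} [NormedAddCommGroup E] [InnerProductSpace ℝ E] {b : HilbertBasis ℕ ℝ E}

/-- Cauchy–Schwarz gives `‖u‖² ≤ ‖f‖ ‖u‖`; one factor cancels unless `u = 0`. -/
theorem HasPettisIntegral.norm_le_of_shift [MeasurableSpace E] {ν : Measure E}
    [IsProbabilityMeasure ν] {f u : HE b}
    (hu : HasPettisIntegral ν (fun h => shift b h f) u) : ‖u‖ ≤ ‖f‖ := by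
  have h := hu.norm_sq_le (K := ‖f‖ * ‖u‖) fun h =>
    (norm_inner_le_norm _ _).trans_eq (by rw [norm_shift])
  rcases (norm_nonneg u).eq_or_lt with h0 | h0
  · rw [← h0]; exact norm_nonneg f
  · rw [sq] at h
    exact le_of_mul_le_mul_right h h0

theorem AbsBlock.vol_nonneg (Q : AbsBlock b) : 0 ≤ Q.vol := by
  rw [← ringVol_carrier]
  exact ringVol_nonneg (carrier_mem_blockRing Q)

/-- A common bound for the edges lets one Laplace kernel serve all coordinates. -/
theorem AbsBlock.exists_edge_le (Q : AbsBlock b) : ∃ C > 0, ∀ j, Q.hi j - Q.lo j ≤ C := by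
  obtain ⟨C, hC⟩ := Q.lo_bdd
  obtain ⟨D, hD⟩ := Q.hi_bdd
  refine ⟨C + D, ?_, fun j => ?_⟩
  · have := abs_le.1 (hC 0)
    have := abs_le.1 (hD 0)
    linarith [Q.lt 0]
  · have := abs_le.1 (hC j)
    have := abs_le.1 (hD j)
    linarith

/-- With `l = q - p` the overlap is `max(0, l - |s - t|)`, and `1 - x ≤ e^{-x}` at `x = |s - t| /
l`. Replacing `l` by the larger `C` in the exponent only increases the bound. -/
theorem max_zero_overlap_le {p q s t C : ℝ} (hpq : p < q) (hC : q - p ≤ C) :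
    max 0 (min (q + s) (q + t) - max (p + s) (p + t)) ≤
      (q - p) * Real.exp (-(|s - t| / C)) := by
  have hl : 0 < q - p := sub_pos.2 hpq
  have h1 : Real.exp (-(|s - t| / (q - p))) ≤ Real.exp (-(|s - t| / C)) :=
    Real.exp_le_exp.2 (neg_le_neg (div_le_div_of_nonneg_left (abs_nonneg _) hl hC))
  have h2 := Real.add_one_le_exp (-(|s - t| / (q - p)))
  have h3 : (q - p) * (-(|s - t| / (q - p)) + 1) = q - p - |s - t| := by field_simp; ring
  have h4 : q - p - |s - t| ≤ (q - p) * Real.exp (-(|s - t| / C)) := by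
    rw [← h3]
    exact mul_le_mul_of_nonneg_left (h2.trans h1) hl.le
  refine max_le (by positivity) (le_trans ?_ h4)
  rw [min_add_add_left, max_add_add_left]
  have := max_sub_min_eq_abs s t
  rw [abs_sub_comm] at this
  linarith

/-- The edgewise bound is multiplied over `N` coordinates and `N → ∞`. Decay is kept only in the
first `n` of them, so that the kernel depends on finitely many coordinates. -/
theorem lam_shift_inter_shift_le (W : AbsBlock b) {C : ℝ} (hC : ∀ j, W.hi j - W.lo j ≤ C)
    (h h' : E) (n : ℕ) :
    lam b ((W.shift h).carrier ∩ (W.shift h').carrier) ≤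
      W.vol * ∏ j ∈ Finset.range n,
        Real.exp (-(|inner ℝ (b j) h - inner ℝ (b j) h'| / C)) := by
  rcases W.carrier.eq_empty_or_nonempty with hW | hW
  · simp [AbsBlock.shift_carrier, hW, lam_empty, AbsBlock.vol]
  refine le_of_tendsto_of_tendsto (tendsto_lam_inter (W.shift_carrier_nonempty h hW)
    (W.shift_carrier_nonempty h' hW)) ((AbsBlock.tendsto_vol hW).mul_const _) ?_
  filter_upwards [eventually_ge_atTop n] with N hN
  set ε : ℕ → ℝ := fun j => Real.exp (-(|inner ℝ (b j) h - inner ℝ (b j) h'| / C)) with hε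
  -- For `N ≥ n`, padding with ones makes the comparison factor by factor.
  have h1 : ∏ j ∈ Finset.range n, ε j = ∏ j ∈ Finset.range N, if j < n then ε j else 1 := by
    rw [← Finset.prod_subset (Finset.range_mono hN) fun j _ hj =>
      if_neg (by simpa using hj)]
    exact Finset.prod_congr rfl fun j hj => (if_pos (Finset.mem_range.1 hj)).symm
  rw [h1, ← Finset.prod_mul_distrib]
  refine Finset.prod_le_prod (fun j _ => le_max_left _ _) fun j _ => ?_
  refine (max_zero_overlap_le (W.lt j) (hC j)).trans ?_
  refine mul_le_mul_of_nonneg_left ?_ (sub_pos.2 (W.lt j)).le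
  split_ifs
  · exact le_rfl
  · refine Real.exp_le_one_iff.2 (neg_nonpos.2 (div_nonneg (abs_nonneg _) ?_))
    exact (sub_pos.2 (W.lt j)).le.trans (hC j)

/-- The order of quantifiers matters: `κ` is chosen before the operator, the measure and `n`, so it
does not deteriorate along a sequence of operators. -/
theorem exists_norm_sq_le [MeasurableSpace E] [BorelSpace E] (W : AbsBlock b) {S : ℝ}
    (hS : 0 < S) :
    ∃ κ > 0, ∀ (A : E →L[ℝ] E) (a : ℕ → ℝ) (ν : Measure E) (u : HE b) (n : ℕ), (∀ k, 0 ≤ a k) →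
      (∀ k, A (b k) = a k • b k) → IsCenteredGaussian ν A → (∀ k < n, √(a k) ≤ S) →
      HasPettisIntegral ν (fun h => shift b h (blockInd W)) u →
      ‖u‖ ^ 2 ≤ W.vol * Real.exp (-(κ * ∑ k ∈ Finset.range n, √(a k))) := by
  obtain ⟨C, hC, hWC⟩ := W.exists_edge_le
  obtain ⟨κ, hκ, hexp⟩ := exists_integral_exp_abs_le hC hS
  refine ⟨κ, hκ, fun A a ν u n ha hA hν haS hu => ?_⟩
  have := hν.1
  refine hu.norm_sq_le fun h => ?_
  -- Second use of the Pettis identity, with the indicator of `W + h` as test vector.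
  rw [shift_blockInd, (hu _).2]
  have hcont : Continuous fun h' : E => W.vol * ∏ j ∈ Finset.range n,
      Real.exp (-(|inner ℝ (b j) h - inner ℝ (b j) h'| / C)) := by fun_prop
  have hle1 : ∀ x : ℝ, Real.exp (-(|x| / C)) ≤ 1 := fun x =>
    Real.exp_le_one_iff.2 (neg_nonpos.2 (by positivity))
  have hbound : ∀ h' : E, |W.vol * ∏ j ∈ Finset.range n,
      Real.exp (-(|inner ℝ (b j) h - inner ℝ (b j) h'| / C))| ≤ W.vol := fun h' => by
    rw [abs_of_nonneg (mul_nonneg W.vol_nonneg (Finset.prod_nonneg fun _ _ => (Real.exp_pos _).le))]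
    exact mul_le_of_le_one_right W.vol_nonneg
      (Finset.prod_le_one (fun _ _ => (Real.exp_pos _).le) fun _ _ => hle1 _)
  refine (norm_integral_le_of_norm_le (integrable_of_continuous_of_abs_le hcont hbound)
    (Eventually.of_forall fun h' => ?_)).trans ?_
  · simp only [shift_blockInd]
    rw [inner_blockInd, Complex.norm_real, Real.norm_eq_abs, abs_of_nonneg]
    · exact lam_shift_inter_shift_le W hWC h h' n
    · refine Real.sInf_nonneg ?_
      rintro _ ⟨A, hA, rfl⟩
      exact ringVol_nonneg hA.1
  rw [integral_const_mul, hν.integral_prod_coords ha hA n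
    (φ := fun j x => Real.exp (-(|inner ℝ (b j) h - x| / C))) (fun j => by fun_prop),
    Finset.mul_sum, ← Finset.sum_neg_distrib, Real.exp_sum]
  refine mul_le_mul_of_nonneg_left (Finset.prod_le_prod
    (fun j _ => integral_nonneg fun x => (Real.exp_pos _).le) fun j hj => ?_) W.vol_nonneg
  -- The centre of the kernel is the coordinate of `h`, on which the bound does not depend.
  have := hexp (√(a j)) (Real.sqrt_nonneg _) (haS j (Finset.mem_range.1 hj)) (inner ℝ (b j) h)
  rwa [Real.sq_sqrt (ha j)] at this

end BlockEstimate

/-! ### The averaging operators as linear contractions and their limit -/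

section Averages

variable {E : Type*} [NormedAddCommGroup E] [InnerProductSpace ℝ E] [MeasurableSpace E]
  [BorelSpace E] {b : HilbertBasis ℕ ℝ E}

/-- Under this hypothesis neither default value, of the Gaussian measure or of the Pettis integral,
enters `avgShift`. -/
theorem hasPettisIntegral_avgShift {A : E →L[ℝ] E} (hA : IsCenteredGaussian (gaussianMeasure A) A)
    (f : HE b) : HasPettisIntegral (gaussianMeasure A) (fun h => shift b h f) (avgShift b A f) := by
  have := hA.1
  obtain ⟨u, hu⟩ := pettisIntegrable_shift (gaussianMeasure A) f
  rwa [avgShift, hu.pettisIntegral_eq]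

theorem avgShift_add {A : E →L[ℝ] E} (hA : IsCenteredGaussian (gaussianMeasure A) A)
    (f g : HE b) : avgShift b A (f + g) = avgShift b A f + avgShift b A g := by
  have h := (hasPettisIntegral_avgShift hA f).add (hasPettisIntegral_avgShift hA g)
  simp_rw [← map_add] at h
  exact (hasPettisIntegral_avgShift hA (f + g)).unique h

theorem avgShift_smul {A : E →L[ℝ] E} (hA : IsCenteredGaussian (gaussianMeasure A) A)
    (z : ℂ) (f : HE b) : avgShift b A (z • f) = z • avgShift b A f := by
  have h := (hasPettisIntegral_avgShift hA f).smul z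
  simp_rw [← map_smul] at h
  exact (hasPettisIntegral_avgShift hA (z • f)).unique h

theorem norm_avgShift_le {A : E →L[ℝ] E} (hA : IsCenteredGaussian (gaussianMeasure A) A)
    (f : HE b) : ‖avgShift b A f‖ ≤ ‖f‖ := by
  have := hA.1
  exact (hasPettisIntegral_avgShift hA f).norm_le_of_shift

/-- Gaussian averages of shifts tend to zero if the sums of the first standard deviations along the
basis tend to infinity. -/
theorem tendsto_avgShift_zero {A : ℕ → E →L[ℝ] E} {a : ℕ → ℕ → ℝ} (ha : ∀ n k, 0 ≤ a n k)
    (hAa : ∀ n k, A n (b k) = a n k • b k)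
    (hA : ∀ n, IsCenteredGaussian (gaussianMeasure (A n)) (A n)) {S : ℝ} (hS : 0 < S)
    (hSa : ∀ n, ∀ k < n, √(a n k) ≤ S)
    (hdiv : Tendsto (fun n => ∑ k ∈ Finset.range n, √(a n k)) atTop atTop) (f : HE b) :
    Tendsto (fun n => avgShift b (A n) f) atTop (𝓝 0) := by
  let T : Submodule ℂ (HE b) :=
    { carrier := {f | Tendsto (fun n => avgShift b (A n) f) atTop (𝓝 0)}
      add_mem' := fun {f g} hf hg => by
        simp only [Set.mem_ofPred_eq, avgShift_add (hA _)] at hf hg ⊢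
        simpa using hf.add hg
      zero_mem' := by
        have h0 : ∀ n, avgShift b (A n) 0 = 0 := fun n =>
          norm_le_zero_iff.1 ((norm_avgShift_le (hA n) 0).trans_eq norm_zero)
        simpa only [Set.mem_ofPred_eq, h0] using tendsto_const_nhds
      smul_mem' := fun z f hf => by
        simp only [Set.mem_ofPred_eq, avgShift_smul (hA _)] at hf ⊢
        simpa using hf.const_smul z }
  -- The averages are contractions uniformly in `n`, so strong convergence to zero survives
  -- approximation of `f`.
  have hclosed : IsClosed (T : Set (HE b)) := isClosed_of_closure_subset fun f hf => by
    change Tendsto (fun n => avgShift b (A n) f) atTop (𝓝 0)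
    rw [NormedAddGroup.tendsto_nhds_zero]
    intro ε hε
    obtain ⟨g, hg, hfg⟩ := Metric.mem_closure_iff.1 hf (ε / 2) (by positivity)
    filter_upwards [NormedAddGroup.tendsto_nhds_zero.1 hg (ε / 2) (by positivity)] with n hn
    rw [dist_eq_norm] at hfg
    have h1 := norm_avgShift_le (hA n) (f - g)
    calc ‖avgShift b (A n) f‖ = ‖avgShift b (A n) g + avgShift b (A n) (f - g)‖ := by
          rw [← avgShift_add (hA n), add_sub_cancel]
      _ ≤ ‖avgShift b (A n) g‖ + ‖avgShift b (A n) (f - g)‖ := norm_add_le _ _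
      _ < ε := by linarith
  have htop : T = ⊤ := closed_submodule_eq_top hclosed fun W => by
    obtain ⟨κ, hκ, hle⟩ := exists_norm_sq_le W hS
    have h1 : Tendsto (fun n => W.vol * Real.exp (-(κ * ∑ k ∈ Finset.range n, √(a n k)))) atTop
        (𝓝 (W.vol * 0)) :=
      (Real.tendsto_exp_neg_atTop_nhds_zero.comp (hdiv.const_mul_atTop hκ)).const_mul _
    rw [mul_zero] at h1
    have h2 := squeeze_zero (fun n => sq_nonneg ‖avgShift b (A n) (blockInd W)‖)
      (fun n => hle (A n) (a n) _ _ n (ha n) (hAa n) (hA n) (hSa n)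
        (hasPettisIntegral_avgShift (hA n) _)) h1
    have h3 := h2.sqrt
    simp only [Real.sqrt_sq (norm_nonneg _), Real.sqrt_zero] at h3
    exact tendsto_zero_iff_norm_tendsto_zero.2 h3
  have hf : f ∈ T := htop ▸ Submodule.mem_top
  exact hf

end Averages

/-! ### The positive square root on the basis, and nuclearity -/

section SquareRoot

variable {E : Type*} [NormedAddCommGroup E] [InnerProductSpace ℝ E]

/-- A positive square root acts on an eigenvector as the square root of the eigenvalue. -/
theorem positive_sqrt_apply_eigenvector {D R : E →L[ℝ] E} (hR : R.IsPositive) (hRD : R ∘L R = D)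
    {d : ℝ} (hd : 0 ≤ d) {v : E} (hv : D v = d • v) : R v = √d • v := by
  have hRR : R (R v) = d • v := by rw [← hv, ← hRD]; rfl
  -- The defect satisfies `R w = -√d w`, so positivity of `R` forces `w = 0` if `d > 0`. For `d = 0`
  -- one has `‖R v‖² = (v, R² v) = 0` instead.
  set w := R v - √d • v with hw
  have hRw : R w = -(√d • w) := by
    rw [hw, map_sub, map_smul, hRR, smul_sub, smul_smul, Real.mul_self_sqrt hd]
    abel
  have h1 : 0 ≤ inner ℝ (R w) w := hR.inner_nonneg_left w
  rw [hRw, inner_neg_left, inner_smul_left, real_inner_self_eq_norm_sq] at h1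
  rcases hd.eq_or_lt with h0 | h0
  · subst h0
    have h2 : inner ℝ (R v) (R v) = (0 : ℝ) := by
      rw [hR.inner_left_eq_inner_right, hRR, zero_smul, inner_zero_right]
    simpa using h2
  · have h3 : 0 < √d := Real.sqrt_pos.2 h0
    simp only [conj_trivial] at h1
    have h4 : ‖w‖ ^ 2 ≤ 0 := by nlinarith
    have h5 : w = 0 := by simpa using le_antisymm h4 (sq_nonneg _)
    exact sub_eq_zero.1 h5

/-- The eigenvector expansion is itself a nuclear representation. In contrapositive form, this turns
non-nuclearity of `D^{1/2}` into divergence of `∑ √d_k`. -/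
theorem isNuclear_of_summable {b : HilbertBasis ℕ ℝ E} {R : E →L[ℝ] E} {s : ℕ → ℝ}
    (hb : ∀ k, R (b k) = s k • b k) (hs : Summable s) : IsNuclear R := by
  refine ⟨fun k => s k • innerSL ℝ (b k), fun k => b k, ?_, fun x => ?_⟩
  · simpa [norm_smul, b.orthonormal.1] using hs.norm
  · have h := (b.hasSum_repr x).mapL R
    have h1 : (fun k => (s k • innerSL ℝ (b k)) x • b k) = fun k => R (b.repr x k • b k) := by
      funext k
      simp [hb, b.repr_apply_apply, smul_smul, mul_comm]
    rwa [h1]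

theorem coordProj_apply_basis (b : HilbertBasis ℕ ℝ E) (n k : ℕ) :
    coordProj b n (b k) = if k < n then b k else 0 := by
  simp [coordProj, orthonormal_iff_ite.1 b.orthonormal, ite_smul]

end SquareRoot

end CoordShift
end

/-! ### Proof of the theorem -/

theorem mainTheorem6 {E : Type*} [NormedAddCommGroup E] [InnerProductSpace ℝ E] [CompleteSpace E]
    [MeasurableSpace E] [BorelSpace E] (b : HilbertBasis ℕ ℝ E) (D : E →L[ℝ] E)
    (hD_nuclear : CoordShift.IsNuclear D) (hD_pos : D.IsPositive)
    (hD_diag : ∀ k, ∃ d : ℝ, D (b k) = d • b k)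
    -- `R` is the positive square root of `D`
    (R : E →L[ℝ] E) (hR_pos : R.IsPositive) (hR_sq : R ∘L R = D)
    (hR_not_nuclear : ¬ CoordShift.IsNuclear R) :
    (∀ t : ℝ, 0 < t → ∀ f : CoordShift.HE b,
      CoordShift.PettisIntegrable (CoordShift.gaussianMeasure (t • D))
        (fun h => CoordShift.shift b h f) ∧
      CoordShift.avgShift b (t • D) f = 0) ∧
    (∀ t : ℝ, 0 < t → ∀ f : CoordShift.HE b,
      (∀ n : ℕ, CoordShift.PettisIntegrable
        (CoordShift.gaussianMeasure (t • (D ∘L CoordShift.coordProj b n)))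
        (fun h => CoordShift.shift b h f)) ∧
      Filter.Tendsto (fun n : ℕ => CoordShift.avgShift b (t • (D ∘L CoordShift.coordProj b n)) f)
        Filter.atTop (nhds 0)) := by
  choose d hd using hD_diag
  have hd0 : ∀ k, 0 ≤ d k := fun k => by
    have h := hD_pos.inner_nonneg_left (b k)
    simpa [hd k, inner_smul_left, b.orthonormal.1 k] using h
  have hds : Summable d := hD_nuclear.summable_eigenvalues b hd0 hd
  have hsqrt : ¬ Summable fun k => √(d k) := fun h => hR_not_nuclear
    (CoordShift.isNuclear_of_summable
      (fun k => CoordShift.positive_sqrt_apply_eigenvector hR_pos hR_sq (hd0 k) (hd k)) h)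
  have hbdd : ∃ S > 0, ∀ k, d k ≤ S :=
    -- The summand `1` only keeps the bound strictly positive when `D = 0` is not yet excluded.
    ⟨1 + ∑' k, d k, add_pos_of_pos_of_nonneg one_pos (tsum_nonneg hd0),
    fun k => by linarith [hds.le_tsum k fun j _ => hd0 j]⟩
  obtain ⟨S, hS, hdS⟩ := hbdd
  have hdiv : ∀ t : ℝ, 0 < t →
      Filter.Tendsto (fun n => ∑ k ∈ Finset.range n, √(t * d k)) Filter.atTop Filter.atTop := by
    intro t ht
    refine (not_summable_iff_tendsto_nat_atTop_of_nonneg fun k => Real.sqrt_nonneg _).1 fun h => ?_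
    simp_rw [Real.sqrt_mul ht.le] at h
    exact hsqrt ((summable_mul_left_iff (Real.sqrt_pos.2 ht).ne').1 h)
  have hSt : ∀ t : ℝ, 0 < t → ∀ k, √(t * d k) ≤ √(t * S) := fun t ht k =>
    Real.sqrt_le_sqrt (mul_le_mul_of_nonneg_left (hdS k) ht.le)
  refine ⟨fun t ht f => ?_, fun t ht f => ?_⟩
  · have h0 : ∀ k, 0 ≤ t * d k := fun k => mul_nonneg ht.le (hd0 k)
    have hA : ∀ k, (t • D) (b k) = (t * d k) • b k := fun k => by simp [hd k, smul_smul]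
    have hG := CoordShift.gaussianMeasure_spec b h0 (hds.mul_left t) hA
    refine ⟨⟨_, CoordShift.hasPettisIntegral_avgShift hG f⟩, ?_⟩
    -- For the constant sequence `tD` the averages do not depend on `n` yet tend to `0`, so they
    -- vanish.
    exact tendsto_nhds_unique tendsto_const_nhds
      (CoordShift.tendsto_avgShift_zero (A := fun _ => t • D) (a := fun _ k => t * d k)
        (fun _ => h0) (fun _ => hA) (fun _ => hG) (Real.sqrt_pos.2 (mul_pos ht hS))
        (fun _ k _ => hSt t ht k) (hdiv t ht) f)
  -- The eigenvalues of `tD_n`. Only finitely many are nonzero, so the Gaussian measure exists.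
  · let a : ℕ → ℕ → ℝ := fun n k => if k < n then t * d k else 0
    have h0 : ∀ n k, 0 ≤ a n k := fun n k => by
      simp only [a]
      split_ifs
      · exact mul_nonneg ht.le (hd0 k)
      · exact le_rfl
    have hA : ∀ n k, (t • (D ∘L CoordShift.coordProj b n)) (b k) = a n k • b k := fun n k => by
      by_cases hk : k < n <;> simp [a, CoordShift.coordProj_apply_basis, hk, hd k, smul_smul]
    have hs : ∀ n, Summable (a n) := fun n => summable_of_ne_finset_zero (s := Finset.range n)
      fun k hk => if_neg (by simpa using hk)
    have hG := fun n => CoordShift.gaussianMeasure_spec b (h0 n) (hs n) (hA n)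
    refine ⟨fun n => ⟨_, CoordShift.hasPettisIntegral_avgShift (hG n) f⟩, ?_⟩
    have ha : ∀ n, ∀ k < n, a n k = t * d k := fun n k hk => if_pos hk
    refine CoordShift.tendsto_avgShift_zero h0 hA hG (Real.sqrt_pos.2 (mul_pos ht hS))
      (fun n k hk => by rw [ha n k hk]; exact hSt t ht k) ?_ f
    -- The sum runs over `k < n`, exactly where the truncation has no effect.
    refine (hdiv t ht).congr fun n => Finset.sum_congr rfl fun k hk => ?_
    rw [ha n k (Finset.mem_range.1 hk)]
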